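/- Let $M\in\mathbb N$, let $\mathbf R\in\mathbb C^{M\times M}$ be a Hermitian positive semidefinite (spatial correlation) matrix with positive semidefinite square root $\mathbf R^{1/2}$, let $\theta_1,\dots,\theta_M\in\mathbb R$ be fixed phases, $\boldsymbol\Phi=\mathrm{diag}(e^{\mathrm i\theta_1},\dots,e^{\mathrm i\theta_M})$, $\mathbf A=\mathbf R^{1/2}\boldsymbol\Phi\mathbf R^{1/2}$ and $\mathbf C=\mathbf A\mathbf A^{\mathsf H}$, and assume $\mathbf A\neq 0$. Let $\mathbf g_{\mathrm f},\mathbf g_{\mathrm u}\sim\mathcal{CN}(\mathbf 0,\mathbf I_M)$ be independent, $G_0=|\mathbf g_{\mathrm u}^{\mathsf H}\mathbf A\mathbf g_{\mathrm f}|^2$, and let $L_{\mathrm f},L_{\mathrm u},R_0>0$. For $\bar\gamma>0$ put $$P_{\mathrm{out}}(\bar\gamma)=\Pr\bigl(\log_2(1+\bar\gamma L_{\mathrm f}L_{\mathrm u}G_0)\le R_0\bigr),\qquad \tilde R=\frac{2^{R_0}-1}{\bar\gamma L_{\mathrm f}L_{\mathrm u}} .$$ Let $\lambda_1,\dots,\lambda_q$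 be the distinct strictly positive eigenvalues of $\mathbf C$, with multiplicities $m_1,\dots,m_q$, and for $1\le k\le m_i$ let $$c_{i,k}=\frac1{(m_i-k)!}\frac{d^{\,m_i-k}}{du^{\,m_i-k}}H_i(u)\Big|_{u=0},\qquad H_i(u)=\prod_{j\ne i}\Bigl(\frac{\lambda_j}{\lambda_i}u+1-\frac{\lambda_j}{\lambda_i}\Bigr)^{-m_j}.$$ Let $K_\nu$ be the modified Bessel function of the second kind, and let $F_K(k,\lambda,\cdot)$ be the distribution function of the $K$-distribution with shape $k$ and scale $\lambda$, i.e. $F_K(k,\lambda,x)=\int_0^x \frac{2\lambda^{-(k+1)/2}}{\Gamma(k)}g^{(k-1)/2}K_{k-1}\bigl(2\sqrt{g/\lambda}\bigr)\,dg$. Put $$S_1=\sum_{i=1}^q\frac{c_{i,1}}{\lambda_i},\qquad S_2=\sum_{i=1}^q\frac{c_{i,1}\log\lambda_i}{\lambda_i},\qquad S_3=\sum_{i=1}^q\sum_{k=2}^{m_i}\frac{c_{i,k}}{(k-1)\lambda_i}.$$ Write $f\simeq g$ if $f(\bar\gamma)/g(\bar\gamma)\to1$ as $\bar\gamma\to\infty$.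 Then the following hold (all exact formulas for every $\bar\gamma>0$). (0) For every integer $k\ge1$ and all $\lambda,x>0$, $F_K(k,\lambda,x)=1-\frac{2}{\Gamma(k)}(x/\lambda)^{k/2}K_k\bigl(2\sqrt{x/\lambda}\bigr)$. (1) General case: $P_{\mathrm{out}}=\sum_{i=1}^q\sum_{k=1}^{m_i}c_{i,k}F_K(k,\lambda_i,\tilde R)$ and $$P_{\mathrm{out}}\simeq\frac{2^{R_0}-1}{L_{\mathrm f}L_{\mathrm u}\bar\gamma}\Bigl[S_1\log\bar\gamma-S_1\log\frac{2^{R_0}-1}{L_{\mathrm f}L_{\mathrm u}}+S_2+S_3\Bigr].$$ (2) Simple eigenvalues: if $m_i=1$ for all $i$, then $c_{i,1}=\prod_{j\neq i}\frac{\lambda_i}{\lambda_i-\lambda_j}$, $P_{\mathrm{out}}=\sum_{i=1}^q c_{i,1}\bigl(1-2\sqrt{\tilde R/\lambda_i}\,K_1(2\sqrt{\tilde R/\lambda_i})\bigr)$, and $P_{\mathrm{out}}\simeq\frac{2^{R_0}-1}{L_{\mathrm f}L_{\mathrm u}\bar\gamma}\bigl[S_1\log\bar\gamma-S_1\log\frac{2^{R_0}-1}{L_{\mathrm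 f}L_{\mathrm u}}+S_2\bigr]$. (3) Equal eigenvalues: if $q=1$, then $P_{\mathrm{out}}=1-\frac{2}{\Gamma(m_1)}\lambda_1^{-m_1/2}\tilde R^{m_1/2}K_{m_1}\bigl(2\sqrt{\tilde R/\lambda_1}\bigr)$, and if moreover $m_1\ge2$, then $P_{\mathrm{out}}\simeq\frac{2^{R_0}-1}{(m_1-1)\lambda_1L_{\mathrm f}L_{\mathrm u}\bar\gamma}$. (4) Uncorrelated case: if $\mathbf R=\mathbf I_M$, then $P_{\mathrm{out}}=1-\frac{2}{\Gamma(M)}\tilde R^{M/2}K_M\bigl(2\sqrt{\tilde R}\bigr)$, and if moreover $M\ge2$, then $P_{\mathrm{out}}\simeq\frac{2^{R_0}-1}{(M-1)L_{\mathrm f}L_{\mathrm u}\bar\gamma}$. (5) Diversity order: in all cases, $\displaystyle-\lim_{\bar\gamma\to\infty}\frac{\log P_{\mathrm{out}}(\bar\gamma)}{\log\bar\gamma}=1$. -/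

import Mathlib

open MeasureTheory ProbabilityTheory Filter Topology
open scoped Matrix NNReal ComplexOrder MatrixOrder

noncomputable section

namespace FRIS

/-- The circularly symmetric complex Gaussian law `CN(0, 1)`: real and imaginary parts are
independent centred real Gaussians of variance `1 / 2`. -/
def cgauss : Measure ℂ :=
  ((gaussianReal 0 (1 / 2 : ℝ≥0)).prod (gaussianReal 0 (1 / 2 : ℝ≥0))).map
    Complex.measurableEquivRealProd.symm

/-- The law `CN(0, I_M)` of a vector of `M` independent `CN(0, 1)` entries. -/
def cgaussVec (M : ℕ) : Measure (Fin M → ℂ) :=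
  Measure.pi fun _ => cgauss

/-- The reflection matrix `Φ = diag(e^{i θ_1}, …, e^{i θ_M})`. -/
def reflection {M : ℕ} (θ : Fin M → ℝ) : Matrix (Fin M) (Fin M) ℂ :=
  Matrix.diagonal fun l => Complex.exp (θ l * Complex.I)

/-- The composite coupling matrix `A = R^{1/2} Φ R^{1/2}`, with `R^{1/2}` the positive
semidefinite square root of `R`. -/
def coupling {M : ℕ} (R : Matrix (Fin M) (Fin M) ℂ) (θ : Fin M → ℝ) :
    Matrix (Fin M) (Fin M) ℂ :=
  CFC.sqrt R * reflection θ * CFC.sqrt R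

/-- The matrix `C = A Aᴴ`. -/
def gram {M : ℕ} (R : Matrix (Fin M) (Fin M) ℂ) (θ : Fin M → ℝ) :
    Matrix (Fin M) (Fin M) ℂ :=
  coupling R θ * (coupling R θ)ᴴ

/-- The end-to-end channel gain `G₀ = |guᴴ A gf|²`. -/
def gain {M : ℕ} (A : Matrix (Fin M) (Fin M) ℂ) (gu gf : Fin M → ℂ) : ℝ :=
  ‖star gu ⬝ᵥ (A *ᵥ gf)‖ ^ 2

/-- The outage probability `Pr(log₂ (1 + γ) ≤ R₀)`, where `γ = snr * Lf * Lu * G₀` is the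
instantaneous signal-to-noise ratio at average signal-to-noise ratio `snr`. -/
def outage {Ω : Type*} [MeasurableSpace Ω] (P : Measure Ω) (G : Ω → ℝ)
    (Lf Lu R₀ snr : ℝ) : ℝ :=
  P.real {ω | Real.logb 2 (1 + snr * Lf * Lu * G ω) ≤ R₀}

/-- The normalized threshold `(2^{R₀} - 1) / (snr * Lf * Lu)`. -/
def threshold (Lf Lu R₀ snr : ℝ) : ℝ :=
  ((2 : ℝ) ^ R₀ - 1) / (snr * Lf * Lu)

/-- The modified Bessel function of the second kind `K_ν(z)`, for real `ν` and `z > 0`, by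
its integral representation. -/
def besselK (ν z : ℝ) : ℝ :=
  ∫ t in Set.Ioi (0 : ℝ), Real.exp (-z * Real.cosh t) * Real.cosh (ν * t)

/-- The density on `(0, ∞)` of the `K`-distribution with shape `k` and scale `l`. -/
def kPDF (k : ℕ) (l g : ℝ) : ℝ :=
  2 * l ^ (-((k : ℝ) + 1) / 2) / Real.Gamma k * g ^ (((k : ℝ) - 1) / 2) *
    besselK ((k : ℝ) - 1) (2 * √(g / l))

/-- The cumulative distribution function of the `K`-distribution at `x`. -/
def kCDF (k : ℕ) (l x : ℝ) : ℝ :=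
  ∫ g in Set.Ioc 0 x, kPDF k l g

/-- `lam` enumerates the distinct strictly positive eigenvalues of `C`, and `m` lists their
multiplicities. -/
structure IsPosSpectrum {M q : ℕ} (C : Matrix (Fin M) (Fin M) ℂ)
    (lam : Fin q → ℝ) (m : Fin q → ℕ) : Prop where
  injective : Function.Injective lam
  mem_iff : ∀ x : ℝ, (∃ i, lam i = x) ↔
    0 < x ∧ Module.End.HasEigenvalue (Matrix.toLin' C) (x : ℂ)
  mult : ∀ i, m i = C.charpoly.rootMultiplicity (lam i : ℂ)

section Coefficients

variable {q : ℕ} (lam : Fin q → ℝ) (m : Fin q → ℕ)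

/-- `H_i(u) = ∏_{j ≠ i} ((λ_j / λ_i) u + 1 - λ_j / λ_i)^{-m_j}`. -/
def auxH (i : Fin q) (u : ℝ) : ℝ :=
  ∏ j ∈ Finset.univ.erase i, (lam j / lam i * u + 1 - lam j / lam i) ^ (-(m j : ℤ))

/-- `c_{i,k} = H_i^{(m_i - k)}(0) / (m_i - k)!`, used for `1 ≤ k ≤ m_i`. -/
def coeff (i : Fin q) (k : ℕ) : ℝ :=
  iteratedDeriv (m i - k) (auxH lam m i) 0 / (m i - k).factorial

def S₁ : ℝ := ∑ i, coeff lam m i 1 / lam i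

def S₂ : ℝ := ∑ i, coeff lam m i 1 * Real.log (lam i) / lam i

def S₃ : ℝ := ∑ i, ∑ k ∈ Finset.Icc 2 (m i), coeff lam m i k / (((k : ℝ) - 1) * lam i)

end Coefficients

end FRIS

end

open FRIS

namespace FRIS

/-! Fix `gu`. Then `guᴴ A gf` is a centred complex Gaussian of variance `Q = ‖Aᴴ gu‖² = guᴴ C gu`,
so `G₀ ≤ x` has conditional probability `1 - exp(-x/Q)` and the outage probability is `E[1 -
exp(-x/Q)]` at `x = c / snr`, with `c = (2^R₀ - 1) / (Lf Lu)` (`prod_real_gain_le`). By unitary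
invariance `Q` has the law of `∑ d_l |w_l|²`, with `d_l` the eigenvalues of `C`.

Exact formula: the characteristic function of `Q` is `∏ (1 - i t λ_i)^(-m_i)`, and partial fractions
(`sum_coeff_mul_inv_pow`) make it `∑ c_{i,k} (1 - i t λ_i)^(-k)`, a signed mixture of gamma
characteristic functions. Hence `E[f(Q)]` is the same signed combination of gamma expectations
(`integral_eq_sum_of_charFun_eq_sum`). For `f(t) = 1 - exp(-x/t)` the gamma expectation is the
K-distribution function, because a K variable is an exponential with gamma-distributed mean
(`kPDF_eq`).

Asymptotics: the behaviour as `x → 0+` depends on the rank `∑ m_i` of `C`. If it is at least 2, then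
`S₁ = 0`, `1/Q` is integrable, and dominated convergence gives `E[1 - exp(-x/Q)] / x → E[1/Q]`. This
mean is the integral over `s > 0` of the Laplace transform `∏ (1 + s λ_i)^(-m_i)`, which the same
partial fractions evaluate as `S₂ + S₃` (`integral_prod_inv_pow`); it is positive. If the rank is 1,
`1/Q` is not integrable and a logarithm appears; explicit two-sided bounds give `y log(1/y) + O(y)`
with `y = x/λ` (`tendsto_kCDF_one_div`). In both cases the outage is `x` times a factor that is at
most logarithmic, so the diversity order is one. -/

instance : IsProbabilityMeasure cgauss :=
  Measure.isProbabilityMeasure_map (by fun_prop)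

instance (M : ℕ) : IsProbabilityMeasure (cgaussVec M) := by
  unfold cgaussVec; infer_instance

/-! ### Transforms and invariance of complex Gaussian vectors. -/

theorem integral_cgauss (f : ℂ → ℂ) :
    ∫ z, f z ∂cgauss = ∫ p : ℝ × ℝ, f ⟨p.1, p.2⟩
      ∂((gaussianReal 0 (1 / 2 : ℝ≥0)).prod (gaussianReal 0 (1 / 2 : ℝ≥0))) := by
  rw [cgauss, integral_map_equiv]
  rfl

theorem integral_cgauss_cexp_re (a : ℂ) :
    ∫ z, Complex.exp ((star a * z).re * Complex.I) ∂cgauss = Complex.exp (-(‖a‖ ^ 2 / 4 : ℝ)) := by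
  have h (t : ℝ) : ∫ x, Complex.exp ((t * x : ℝ) * Complex.I) ∂gaussianReal 0 (1 / 2 : ℝ≥0)
      = Complex.exp (-(t ^ 2 / 4 : ℝ)) := by
    have := charFun_gaussianReal (μ := 0) (v := (1 / 2 : ℝ≥0)) t
    rw [charFun_apply_real] at this
    convert this using 2
    · simp
    · push_cast; ring_nf
  rw [integral_cgauss]
  have : ∀ p : ℝ × ℝ, Complex.exp (((star a * (⟨p.1, p.2⟩ : ℂ)).re : ℝ) * Complex.I) =
      Complex.exp ((a.re * p.1 : ℝ) * Complex.I) * Complex.exp ((a.im * p.2 : ℝ) * Complex.I) := by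
    intro p
    rw [← Complex.exp_add]
    congr 1
    simp [Complex.mul_re]
    ring
  simp_rw [this]
  rw [integral_prod_mul (fun x : ℝ => Complex.exp ((a.re * x : ℝ) * Complex.I))
    (fun x : ℝ => Complex.exp ((a.im * x : ℝ) * Complex.I)), h, h, ← Complex.exp_add]
  congr 1
  rw [← Complex.normSq_eq_norm_sq, Complex.normSq_apply]
  push_cast; ring

/-- The closed half-plane is allowed so that one formula covers both the characteristic function (`z
= -i t`) and the Laplace transform (`z = s > 0`). The integral splits into two real Gaussian
integrals with parameter `1 + z`. -/
theorem integral_cgauss_cexp_normSq {z : ℂ} (hz : 0 ≤ z.re) :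
    ∫ w, Complex.exp (-z * (‖w‖ ^ 2 : ℝ)) ∂cgauss = (1 + z)⁻¹ := by
  rw [integral_cgauss]
  have : ∀ p : ℝ × ℝ, Complex.exp (-z * (‖(⟨p.1, p.2⟩ : ℂ)‖ ^ 2 : ℝ)) =
      Complex.exp (-z * p.1 ^ 2) * Complex.exp (-z * p.2 ^ 2) := by
    intro p
    rw [← Complex.exp_add, ← Complex.normSq_eq_norm_sq, Complex.normSq_apply]
    congr 1
    push_cast; ring
  simp_rw [this]
  rw [integral_prod_mul (fun x : ℝ => Complex.exp (-z * x ^ 2))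
    (fun x : ℝ => Complex.exp (-z * x ^ 2)),
    integral_gaussianReal_eq_integral_smul (by norm_num)]
  have hre : 0 < (1 + z).re := by simp; linarith
  have h : ∀ x : ℝ, gaussianPDFReal 0 (1 / 2 : ℝ≥0) x • Complex.exp (-z * x ^ 2) =
      ((√Real.pi)⁻¹ : ℝ) * Complex.exp (-(1 + z) * x ^ 2) := by
    intro x
    rw [gaussianPDFReal_def, Complex.real_smul]
    push_cast
    rw [mul_assoc, ← Complex.exp_add]
    have h2 : 2 * Real.pi * (1 / 2 : ℝ) = Real.pi := by ring
    congr 1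
    · simp only [h2]
    · congr 1
      field_simp; ring
  simp_rw [h]
  rw [integral_const_mul, ← sq, mul_pow, integral_gaussian_sq_complex hre]
  have hpi : (Real.pi : ℂ) ≠ 0 := by exact_mod_cast Real.pi_ne_zero
  rw [← Complex.ofReal_pow, inv_pow, Real.sq_sqrt Real.pi_pos.le]
  push_cast
  field_simp

theorem integral_cgaussVec_cexp_re {M : ℕ} (a : Fin M → ℂ) :
    ∫ z, Complex.exp ((star a ⬝ᵥ z).re * Complex.I) ∂cgaussVec M =
      Complex.exp (-((∑ l, ‖a l‖ ^ 2) / 4 : ℝ)) := by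
  have : ∀ z : Fin M → ℂ, Complex.exp ((star a ⬝ᵥ z).re * Complex.I) =
      ∏ l, Complex.exp ((star (a l) * z l).re * Complex.I) := by
    intro z
    rw [← Complex.exp_sum, dotProduct, Complex.re_sum, Complex.ofReal_sum, Finset.sum_mul]
    rfl
  simp_rw [this]
  rw [cgaussVec, integral_fintype_prod_eq_prod
    (fun l (w : ℂ) => Complex.exp ((star (a l) * w).re * Complex.I))]
  simp_rw [integral_cgauss_cexp_re]
  rw [← Complex.exp_sum]
  congr 1
  push_cast
  rw [Finset.sum_neg_distrib, Finset.sum_div]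

theorem integral_cgaussVec_cexp_normSq {M : ℕ} (d : Fin M → ℝ) (hd : ∀ l, 0 ≤ d l) {z : ℂ}
    (hz : 0 ≤ z.re) :
    ∫ w, Complex.exp (-z * (∑ l, d l * ‖w l‖ ^ 2 : ℝ)) ∂cgaussVec M =
      ∏ l, (1 + z * d l)⁻¹ := by
  have : ∀ w : Fin M → ℂ, Complex.exp (-z * (∑ l, d l * ‖w l‖ ^ 2 : ℝ)) =
      ∏ l, Complex.exp (-(z * d l) * (‖w l‖ ^ 2 : ℝ)) := by
    intro w
    rw [← Complex.exp_sum]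
    congr 1
    push_cast
    rw [Finset.mul_sum]
    exact Finset.sum_congr rfl fun l _ => by ring
  simp_rw [this]
  rw [cgaussVec, integral_fintype_prod_eq_prod
    (fun l (w : ℂ) => Complex.exp (-(z * d l) * (‖w‖ ^ 2 : ℝ)))]
  refine Finset.prod_congr rfl fun l _ => integral_cgauss_cexp_normSq ?_
  simpa using mul_nonneg hz (hd l)

/-- Both characteristic functions at `t` equal `exp(-|t|² ‖v‖² / 4)`. -/
theorem map_dotProduct_cgaussVec {M : ℕ} (v : Fin M → ℂ) :
    (cgaussVec M).map (fun z => star v ⬝ᵥ z) =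
      cgauss.map (fun z => (√(∑ l, ‖v l‖ ^ 2) : ℂ) * z) := by
  have hm : Measurable fun z : Fin M → ℂ => star v ⬝ᵥ z := by
    unfold dotProduct; fun_prop
  have hm' : Measurable fun z : ℂ => (√(∑ l, ‖v l‖ ^ 2) : ℂ) * z := by fun_prop
  have := Measure.isProbabilityMeasure_map (μ := cgaussVec M) hm.aemeasurable
  have := Measure.isProbabilityMeasure_map (μ := cgauss) hm'.aemeasurable
  apply Measure.ext_of_charFun
  ext t
  rw [charFun_apply, charFun_apply, integral_map hm.aemeasurable (by fun_prop),
    integral_map hm'.aemeasurable (by fun_prop)]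
  have h1 : ∀ z : Fin M → ℂ, inner ℝ (star v ⬝ᵥ z) t = (star (t • v) ⬝ᵥ z).re := by
    intro z
    rw [real_inner_comm, star_smul, smul_dotProduct, Complex.inner]
    simp; ring
  have h2 : ∀ z : ℂ, inner ℝ ((√(∑ l, ‖v l‖ ^ 2) : ℂ) * z) t =
      (star (t * (√(∑ l, ‖v l‖ ^ 2) : ℂ)) * z).re := by
    intro z
    rw [real_inner_comm, Complex.inner, star_mul, mul_comm (star _) (star t)]
    congr 1
    simp; ring
  simp_rw [h1, h2]
  rw [integral_cgaussVec_cexp_re, integral_cgauss_cexp_re]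
  congr 4
  rw [norm_mul, mul_pow, Complex.norm_real, Real.norm_eq_abs, sq_abs, Real.sq_sqrt (by positivity)]
  simp [mul_pow, Finset.mul_sum]

/-- The characteristic function at the functional `z ↦ Re (aᴴ z)` depends only on `‖a‖`, and
composing with `U` replaces `a` by `Uᴴ a`, which has the same norm. -/
theorem map_mulVec_cgaussVec {M : ℕ} (U : Matrix (Fin M) (Fin M) ℂ) (hU : U * Uᴴ = 1) :
    (cgaussVec M).map (fun z => U *ᵥ z) = cgaussVec M := by
  have hm : Measurable fun z : Fin M → ℂ => U *ᵥ z := by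
    unfold Matrix.mulVec dotProduct; fun_prop
  have := Measure.isProbabilityMeasure_map (μ := cgaussVec M) hm.aemeasurable
  apply Measure.ext_of_charFunDual
  ext L
  rw [charFunDual_apply, charFunDual_apply, integral_map hm.aemeasurable (by fun_prop)]
  obtain ⟨a, ha⟩ : ∃ a : Fin M → ℂ, ∀ z, L z = (star a ⬝ᵥ z).re := by
    -- A real-linear functional on `ℂ^M` is determined by its values at `e_l` and `i e_l`; these are
    -- the real and imaginary parts of `a l`.
    refine ⟨fun l => ⟨L (Pi.single l (1 : ℂ)), L (Pi.single l Complex.I)⟩, fun z => ?_⟩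
    have hz : z = ∑ l, ((z l).re • (Pi.single l 1 : Fin M → ℂ) +
        (z l).im • (Pi.single l Complex.I : Fin M → ℂ)) := by
      ext l
      simp [Finset.sum_apply, Pi.single_apply, Finset.sum_add_distrib]
    conv_lhs => rw [hz]
    simp only [map_sum, map_add, map_smul, dotProduct, Complex.re_sum]
    refine Finset.sum_congr rfl fun l _ => ?_
    simp [mul_comm]
  have h1 : ∀ z, L (U *ᵥ z) = (star (Uᴴ *ᵥ a) ⬝ᵥ z).re := by
    intro z
    rw [ha, Matrix.star_mulVec, Matrix.conjTranspose_conjTranspose, Matrix.dotProduct_mulVec]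
  simp_rw [h1, ha]
  rw [integral_cgaussVec_cexp_re, integral_cgaussVec_cexp_re]
  have h2 : ∀ b : Fin M → ℂ, ((∑ l, ‖b l‖ ^ 2 : ℝ) : ℂ) = star b ⬝ᵥ b := by
    intro b
    simp [dotProduct, Complex.conj_mul']
  congr 3
  rw [← Complex.ofReal_inj] 
  push_cast
  congr 1
  have := h2 (Uᴴ *ᵥ a)
  have h3 := h2 a
  push_cast at this h3
  rw [this, h3, Matrix.star_mulVec, Matrix.conjTranspose_conjTranspose, ← Matrix.dotProduct_mulVec,
    Matrix.mulVec_mulVec, hU, Matrix.one_mulVec]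

/-! ### Gamma integrals with complex rate, and the exponential law of the squared modulus. -/

theorem integrableOn_pow_mul_exp_neg_mul (n : ℕ) {b : ℝ} (hb : 0 < b) :
    IntegrableOn (fun t : ℝ => t ^ n * Real.exp (-b * t)) (Set.Ioi 0) := by
  have := integrableOn_rpow_mul_exp_neg_mul_rpow (p := 1) (s := n) (b := b)
    (by have := n.cast_nonneg (α := ℝ); linarith) one_pos hb
  simpa using this

theorem integrableOn_pow_mul_cexp_neg_mul (n : ℕ) {r : ℂ} (hr : 0 < r.re) :
    IntegrableOn (fun t : ℝ => (t : ℂ) ^ n * Complex.exp (-r * t)) (Set.Ioi 0) := by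
  refine (integrableOn_pow_mul_exp_neg_mul n hr).mono' (by fun_prop) ?_
  filter_upwards [ae_restrict_mem measurableSet_Ioi] with t ht
  rw [norm_mul, norm_pow, Complex.norm_exp, Complex.norm_real, Real.norm_eq_abs,
    abs_of_pos ht]
  simp

/-- Induction by parts: the derivative of `t^(n+1) exp(-r t)` integrates to zero over the half-line,
which links consecutive exponents. -/
theorem integral_pow_mul_cexp_neg_mul (n : ℕ) {r : ℂ} (hr : 0 < r.re) :
    ∫ t : ℝ in Set.Ioi 0, (t : ℂ) ^ n * Complex.exp (-r * t) = n.factorial / r ^ (n + 1) := by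
  have hr0 : r ≠ 0 := by rintro rfl; simp at hr
  have hd (n : ℕ) (t : ℝ) : HasDerivAt (fun t : ℝ => (t : ℂ) ^ n * Complex.exp (-r * t))
      (n * (t : ℂ) ^ (n - 1) * Complex.exp (-r * t) +
        (t : ℂ) ^ n * (Complex.exp (-r * t) * (-r))) t := by
    have h1 : HasDerivAt (fun t : ℝ => (t : ℂ)) 1 t := Complex.ofRealCLM.hasDerivAt
    have := (h1.pow n).mul ((h1.const_mul (-r)).cexp)
    simpa [Pi.mul_def] using this
  have ht (n : ℕ) :
      Tendsto (fun t : ℝ => (t : ℂ) ^ n * Complex.exp (-r * t)) atTop (𝓝 0) := by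
    rw [tendsto_zero_iff_norm_tendsto_zero]
    have := Real.tendsto_pow_mul_exp_neg_atTop_nhds_zero n
    have h2 := (this.comp (tendsto_id.const_mul_atTop hr)).const_mul ((r.re ^ n)⁻¹)
    rw [mul_zero] at h2
    refine h2.congr' ?_
    filter_upwards [eventually_gt_atTop 0] with t ht
    rw [norm_mul, norm_pow, Complex.norm_exp, Complex.norm_real, Real.norm_eq_abs,
      abs_of_pos ht]
    simp [mul_pow]
    field_simp
  induction n with
  | zero =>
    have h := integral_Ioi_of_hasDerivAt_of_tendsto (a := 0)
      (hd 0 0).continuousAt.continuousWithinAt (fun t _ => hd 0 t) ?_ (ht 0)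
    · simp only [Nat.cast_zero, zero_mul, zero_add, pow_zero, one_mul] at h ⊢
      rw [integral_mul_const] at h
      simp at h
      field_simp
      simp
      linear_combination h
    · have := (integrableOn_pow_mul_cexp_neg_mul 0 hr).mul_const (-r)
      simpa [IntegrableOn] using this
  | succ n ih =>
    have i1 := (integrableOn_pow_mul_cexp_neg_mul n hr).const_mul ((n + 1 : ℕ) : ℂ)
    have i2 := (integrableOn_pow_mul_cexp_neg_mul (n + 1) hr).mul_const (-r)
    have h := integral_Ioi_of_hasDerivAt_of_tendsto (a := 0)
      (hd (n + 1) 0).continuousAt.continuousWithinAt (fun t _ => hd (n + 1) t) ?_ (ht (n + 1))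
    · simp only [Nat.add_sub_cancel, ← mul_assoc] at h
      simp only [← mul_assoc] at i2 i1
      rw [integral_add i1 i2, integral_mul_const] at h
      simp_rw [mul_assoc] at h
      rw [integral_const_mul, ih] at h
      simp at h
      simp only [Nat.factorial_succ]
      push_cast
      field_simp at h ⊢
      linear_combination -h
    · simpa [IntegrableOn, mul_assoc, Pi.add_def] using i1.add i2

theorem charFun_gammaMeasure_nat {k : ℕ} (hk : 1 ≤ k) {r : ℝ} (hr : 0 < r) (t : ℝ) :
    charFun (gammaMeasure k r) t = ((1 - t * Complex.I / r) ^ k)⁻¹ := by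
  rw [charFun_apply_real, gammaMeasure, integral_withDensity_eq_integral_toReal_smul₀
    (by unfold gammaPDF; fun_prop) (by simp [gammaPDF])]
  have h0 : ∀ x, (gammaPDF k r x).toReal = gammaPDFReal k r x := fun x =>
    ENNReal.toReal_ofReal (gammaPDFReal_nonneg (by positivity) hr x)
  simp_rw [h0]
  obtain ⟨n, rfl⟩ : ∃ n, k = n + 1 := ⟨k - 1, by omega⟩
  have h1 : ∀ x, gammaPDFReal (n + 1 : ℕ) r x • Complex.exp (t * x * Complex.I) =
      Set.indicator (Set.Ici 0) (fun x : ℝ => ((r ^ (n + 1) / n.factorial : ℝ) : ℂ) *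
        ((x : ℂ) ^ n * Complex.exp (-(r - t * Complex.I) * x))) x := by
    intro x
    rw [gammaPDFReal]
    split_ifs with hx
    · rw [Set.indicator_of_mem (by exact hx), Complex.real_smul, Real.rpow_natCast]
      push_cast
      rw [add_sub_cancel_right, Real.Gamma_nat_eq_factorial,
        Real.rpow_natCast, mul_assoc, ← Complex.exp_add]
      push_cast
      ring_nf
    · rw [Set.indicator_of_notMem (by exact hx), zero_smul]
  simp_rw [h1]
  rw [integral_indicator measurableSet_Ici, integral_Ici_eq_integral_Ioi, integral_const_mul,
    integral_pow_mul_cexp_neg_mul n (by simpa using hr)]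
  have hr' : (r : ℂ) ≠ 0 := by exact_mod_cast hr.ne'
  have hn : (n.factorial : ℂ) ≠ 0 := by exact_mod_cast n.factorial_ne_zero
  have h3 : (r - t * Complex.I : ℂ) = r * (1 - t * Complex.I / r) := by field_simp
  rw [h3, mul_pow]
  push_cast
  field_simp

theorem map_normSq_cgauss : cgauss.map (fun z => ‖z‖ ^ 2) = expMeasure 1 := by
  have := isProbabilityMeasure_expMeasure one_pos
  have hm : Measurable fun z : ℂ => ‖z‖ ^ 2 := by fun_prop
  have := Measure.isProbabilityMeasure_map (μ := cgauss) hm.aemeasurable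
  apply Measure.ext_of_charFun
  ext t
  have h := charFun_gammaMeasure_nat le_rfl one_pos t
  rw [Nat.cast_one] at h
  rw [expMeasure, h, charFun_apply_real, integral_map hm.aemeasurable (by fun_prop)]
  have := integral_cgauss_cexp_normSq (z := -(t * Complex.I)) (by simp)
  simp only [neg_neg] at this
  convert this using 2
  · ext z; ring_nf
  · simp; ring

/-- The distribution function of the squared modulus of `CN(0, s)`, which is exponential. -/
theorem cgauss_real_normSq_mul_le {s x : ℝ} (hs : 0 < s) (hx : 0 < x) :
    cgauss.real {z | s * ‖z‖ ^ 2 ≤ x} = 1 - Real.exp (-(x / s)) := by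
  have := isProbabilityMeasure_expMeasure one_pos
  have hm : Measurable fun z : ℂ => ‖z‖ ^ 2 := by fun_prop
  have h := cdf_expMeasure_eq one_pos (x / s)
  rw [if_pos (by positivity), one_mul, cdf_eq_real, ← map_normSq_cgauss,
    map_measureReal_apply hm measurableSet_Iic] at h
  rw [← h]
  congr 1
  ext z
  simp [le_div_iff₀ hs, mul_comm]

theorem ae_cgauss_ne_zero : ∀ᵐ z ∂cgauss, z ≠ 0 := by
  have h : ∀ᵐ y ∂(cgauss.map fun z => ‖z‖ ^ 2), y ≠ 0 := by
    rw [map_normSq_cgauss, expMeasure, gammaMeasure]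
    exact (withDensity_absolutelyContinuous _ _).ae_le (Measure.ae_ne volume 0)
  filter_upwards [ae_of_ae_map (by fun_prop) h] with z hz
  simpa using hz

theorem ae_cgaussVec_ne_zero {M : ℕ} (l : Fin M) : ∀ᵐ w ∂cgaussVec M, w l ≠ 0 :=
  (Measure.quasiMeasurePreserving_eval (fun _ : Fin M => cgauss) l).ae ae_cgauss_ne_zero

/-! ### Partial fractions with Taylor coefficients. -/

section

open Polynomial in
/-- The Taylor polynomial of `h = 1 / p` at `0` inverts `p` modulo a power of `X`. -/
theorem X_pow_dvd_sum_iteratedDeriv_mul_sub_one (p : ℝ[X]) (h : ℝ → ℝ) (N : ℕ)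
    (hh : ContDiffAt ℝ N h 0) (hp : ∀ᶠ u in 𝓝 (0 : ℝ), h u * p.eval u = 1) :
    X ^ N ∣ (∑ n ∈ Finset.range N, C (iteratedDeriv n h 0 / n.factorial) * X ^ n) * p - 1 := by
  rw [X_pow_dvd_iff]
  intro d hd
  have hcoeff : ∀ n, p.coeff n = iteratedDeriv n (fun u => p.eval u) 0 / n.factorial := by
    intro n
    have hder : ∀ n, deriv^[n] (fun u => p.eval u) = fun u => (derivative^[n] p).eval u := by
      intro n
      induction n with
      | zero => rfl
      | succ n ih =>
        rw [Function.iterate_succ_apply', Function.iterate_succ_apply', ih]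
        ext u
        exact Polynomial.deriv _
    rw [iteratedDeriv_eq_iterate, hder]
    simp only
    rw [← coeff_zero_eq_eval_zero, coeff_iterate_derivative]
    have := n.factorial_ne_zero
    simp [Nat.descFactorial_self]
    field_simp
  -- Since `h * p` is 1 near 0, its derivatives there are known; by Leibniz' rule they are, up to
  -- `d!`, the coefficients of the product of the two Taylor expansions.
  have h1 : iteratedDeriv d (h * fun u => p.eval u) 0 = if d = 0 then 1 else 0 := by
    have : (h * fun u => p.eval u) =ᶠ[𝓝 0] fun _ => (1 : ℝ) := hp
    rw [this.iteratedDeriv_eq, iteratedDeriv_const]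
  have hpc : ContDiff ℝ d fun u => p.eval u := Polynomial.contDiff_aeval p d
  rw [iteratedDeriv_mul (hh.of_le (by exact_mod_cast hd.le))
    hpc.contDiffAt] at h1
  rw [coeff_sub, coeff_mul, coeff_one, Finset.Nat.sum_antidiagonal_eq_sum_range_succ_mk]
  have h2 : ∀ i ∈ Finset.range (d + 1),
      (∑ n ∈ Finset.range N, C (iteratedDeriv n h 0 / n.factorial) * X ^ n).coeff i *
      p.coeff (d - i) = ((d.choose i : ℝ) * iteratedDeriv i h 0 *
        iteratedDeriv (d - i) (fun u => p.eval u) 0) / d.factorial := by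
    intro i hi
    rw [Finset.mem_range] at hi
    rw [finsetSum_coeff, hcoeff]
    simp only [coeff_C_mul_X_pow]
    rw [Finset.sum_ite_eq, if_pos (Finset.mem_range.2 (by omega)),
      Nat.cast_choose ℝ (by omega : i ≤ d)]
    have := d.factorial_ne_zero
    field_simp
  rw [Finset.sum_congr rfl h2, ← Finset.sum_div, h1]
  split_ifs with h0 <;> simp [h0]

variable {q : ℕ} (lam : Fin q → ℝ) (m : Fin q → ℕ)

open Polynomial in
-- The partial fraction identity with denominators cleared. Let `N` be the left side and `ℓ_i = 1 +
-- λ_i X`. Modulo `ℓ_i ^ m_i` only the `i`-th block of `N` survives, and there the Taylor polynomial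
-- of `H_i` in `u = ℓ_i` inverts the product of the other factors. So every `ℓ_i ^ m_i` divides `N -
-- 1`; being coprime, so does their product, whose degree `∑ m_i` exceeds that of `N - 1`.
theorem sum_coeff_mul_prod_eq_one (hq : 0 < q) (hlam : ∀ i, 0 < lam i)
    (hinj : Function.Injective lam) (hm : ∀ i, 1 ≤ m i) :
    ∑ i, ∑ k ∈ Finset.Icc 1 (m i), C (coeff lam m i k) * (1 + C (lam i) * X) ^ (m i - k) *
      ∏ j ∈ Finset.univ.erase i, (1 + C (lam j) * X) ^ m j = (1 : ℝ[X]) := by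
  set ℓ : Fin q → ℝ[X] := fun i => 1 + C (lam i) * X with hℓ
  set N := ∑ i, ∑ k ∈ Finset.Icc 1 (m i), C (coeff lam m i k) * ℓ i ^ (m i - k) *
      ∏ j ∈ Finset.univ.erase i, ℓ j ^ m j with hN
  have hdeg : ∀ i, (ℓ i).natDegree = 1 := by
    intro i
    rw [hℓ]
    simp only
    rw [add_comm, ← C_1, natDegree_linear (hlam i).ne']
  have hne : ∀ i, ℓ i ≠ 0 := fun i h => by simpa [h] using hdeg i
  have hcop : Pairwise (Function.onFun IsCoprime fun i => ℓ i ^ m i) := by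
    intro i j hij
    -- Bézout: `λ_j ℓ_i - λ_i ℓ_j = λ_j - λ_i`.
    refine IsCoprime.pow ⟨C (lam j / (lam j - lam i)), C (-(lam i / (lam j - lam i))), ?_⟩
    have : lam j - lam i ≠ 0 := sub_ne_zero.2 fun h => hij (hinj h).symm
    have e1 : C (lam j / (lam j - lam i)) + C (-(lam i / (lam j - lam i))) = (1 : ℝ[X]) := by
      rw [← C_add, ← C_1]; congr 1; field_simp; ring
    have e2 : C (lam j / (lam j - lam i)) * C (lam i) +
        C (-(lam i / (lam j - lam i))) * C (lam j) = (0 : ℝ[X]) := by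
      rw [← C_mul, ← C_mul, ← C_add, ← C_0]; congr 1; ring
    simp only [hℓ]
    linear_combination e1 + X * e2
  have hdvd : ∀ i, ℓ i ^ m i ∣ N - 1 := by
    intro i
    set p : ℝ[X] := ∏ j ∈ Finset.univ.erase i,
      (C (lam j / lam i) * X + C (1 - lam j / lam i)) ^ m j with hp
    have hev : ∀ j ∈ Finset.univ.erase i, lam j / lam i * 0 + 1 - lam j / lam i ≠ 0 := by
      intro j hj
      have : lam j ≠ lam i := fun h => (Finset.mem_erase.1 hj).1 (hinj h)
      rw [mul_zero, zero_add, sub_ne_zero, ne_comm, Ne, div_eq_one_iff_eq (hlam i).ne']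
      exact this
    have key := X_pow_dvd_sum_iteratedDeriv_mul_sub_one p (auxH lam m i) (m i) ?_ ?_
    · obtain ⟨r, hr⟩ := key
      -- Substituting `u = 1 + λ_i X` turns `(λ_j/λ_i) u + 1 - λ_j/λ_i` into `1 + λ_j X`.
      have hcomp : p.comp (ℓ i) = ∏ j ∈ Finset.univ.erase i, ℓ j ^ m j := by
        rw [hp, prod_comp]
        refine Finset.prod_congr rfl fun j _ => ?_
        simp only [pow_comp, add_comp, mul_comp, C_comp, X_comp, hℓ]
        congr 1
        have e1 : C (lam j / lam i) * C (lam i) = (C (lam j) : ℝ[X]) := by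
          rw [← C_mul, div_mul_cancel₀ _ (hlam i).ne']
        rw [C_sub, C_1]
        linear_combination X * e1
      have hT : ∑ n ∈ Finset.range (m i),
          C (iteratedDeriv n (auxH lam m i) 0 / n.factorial) * ℓ i ^ n =
          ∑ k ∈ Finset.Icc 1 (m i), C (coeff lam m i k) * ℓ i ^ (m i - k) := by
        refine Finset.sum_nbij' (fun n => m i - n) (fun k => m i - k) ?_ ?_ ?_ ?_ ?_
        · intro n hn; simp at hn ⊢; omega
        · intro n hn; simp at hn ⊢; omega
        · intro n hn; simp at hn ⊢; omega
        · intro n hn; simp at hn ⊢; omega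
        · intro n hn
          rw [Finset.mem_range] at hn
          rw [coeff, Nat.sub_sub_self hn.le]
      have hr' := congrArg (fun f => f.comp (ℓ i)) hr
      simp only [sub_comp, mul_comp, sum_comp, pow_comp, C_comp, X_comp, one_comp] at hr'
      rw [hcomp, hT, Finset.sum_mul] at hr'
      rw [hN, ← Finset.add_sum_erase _ _ (Finset.mem_univ i), add_sub_right_comm, hr']
      refine dvd_add (dvd_mul_right _ _) (Finset.dvd_sum fun j hj => Finset.dvd_sum fun k _ => ?_)
      refine Dvd.dvd.mul_left (Finset.dvd_prod_of_mem (fun j => ℓ j ^ m j) ?_) _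
      simpa [eq_comm] using hj
    · unfold auxH
      refine contDiffAt_prod fun j hj => ?_
      simp only [zpow_neg, zpow_natCast]
      exact ContDiffAt.inv (by fun_prop) (pow_ne_zero _ (hev j hj))
    · have : ∀ᶠ u in 𝓝 (0 : ℝ), ∀ j ∈ Finset.univ.erase i,
          lam j / lam i * u + 1 - lam j / lam i ≠ 0 := by
        rw [Filter.eventually_all_finset]
        intro j hj
        exact ContinuousAt.eventually_ne (by fun_prop) (hev j hj)
      filter_upwards [this] with u hu
      rw [auxH, hp, eval_prod, ← Finset.prod_mul_distrib]
      refine Finset.prod_eq_one fun j hj => ?_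
      have h1 := hu j hj
      simp only [eval_pow, eval_add, eval_mul, eval_C, eval_X, zpow_neg, zpow_natCast]
      rw [← add_sub_assoc]
      exact inv_mul_cancel₀ (pow_ne_zero _ h1)
  have hall : ∏ i, ℓ i ^ m i ∣ N - 1 :=
    Finset.prod_dvd_of_coprime (hcop.set_pairwise _) fun i _ => hdvd i
  have hD : (∏ i, ℓ i ^ m i).natDegree = ∑ i, m i := by
    rw [natDegree_prod _ _ fun i _ => pow_ne_zero _ (hne i)]
    simp [natDegree_pow, hdeg]
  have hpos : 0 < ∑ i, m i := 
    lt_of_lt_of_le (hm ⟨0, hq⟩) (Finset.single_le_sum (fun i _ => (m i).zero_le) (Finset.mem_univ _))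
  have hNdeg : (N - 1).natDegree < ∑ i, m i := by
    refine lt_of_le_of_lt (natDegree_sub_le _ _) (max_lt ?_ (by simpa using hpos))
    refine lt_of_le_of_lt (natDegree_sum_le_of_forall_le _ _ (n := ∑ i, m i - 1) fun i _ =>
      natDegree_sum_le_of_forall_le _ _ fun k hk => ?_) (by omega)
    rw [Finset.mem_Icc] at hk
    refine natDegree_mul_le.trans ?_
    have h1 : (C (coeff lam m i k) * ℓ i ^ (m i - k)).natDegree ≤ m i - k := by
      refine (natDegree_C_mul_le _ _).trans ?_
      rw [natDegree_pow, hdeg, mul_one]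
    have h2 : (∏ j ∈ Finset.univ.erase i, ℓ j ^ m j).natDegree =
        ∑ j ∈ Finset.univ.erase i, m j := by
      rw [natDegree_prod _ _ fun i _ => pow_ne_zero _ (hne i)]
      simp [natDegree_pow, hdeg]
    have h3 := Finset.add_sum_erase Finset.univ m (Finset.mem_univ i)
    omega
  have := eq_zero_of_dvd_of_natDegree_lt hall (by rwa [hD])
  exact sub_eq_zero.1 this

/-- Partial fraction expansion of `∏ i, (1 + s λ_i) ^ (-m_i)`, in any field over `ℝ`. -/
theorem sum_coeff_mul_inv_pow {K : Type*} [Field K] [Algebra ℝ K] (hq : 0 < q)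
    (hlam : ∀ i, 0 < lam i) (hinj : Function.Injective lam) (hm : ∀ i, 1 ≤ m i) (s : K)
    (hs : ∀ i, 1 + s * algebraMap ℝ K (lam i) ≠ 0) :
    ∏ i, ((1 + s * algebraMap ℝ K (lam i)) ^ m i)⁻¹ =
      ∑ i, ∑ k ∈ Finset.Icc 1 (m i), algebraMap ℝ K (coeff lam m i k) *
        ((1 + s * algebraMap ℝ K (lam i)) ^ k)⁻¹ := by
  have h := congrArg (Polynomial.aeval s) (sum_coeff_mul_prod_eq_one lam m hq hlam hinj hm)
  simp only [map_sum, map_mul, map_prod, map_pow, map_add, map_one, Polynomial.aeval_C,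
    Polynomial.aeval_X] at h
  simp_rw [mul_comm (algebraMap ℝ K (lam _)) s] at h
  rw [← mul_one (∏ i, _)]
  conv_lhs => enter [2]; rw [← h]
  rw [Finset.mul_sum]
  refine Finset.sum_congr rfl fun i _ => ?_
  rw [Finset.mul_sum]
  refine Finset.sum_congr rfl fun k hk => ?_
  rw [Finset.mem_Icc] at hk
  rw [← Finset.mul_prod_erase Finset.univ _ (Finset.mem_univ i), Finset.prod_inv_distrib]
  have h1 : ∏ j ∈ Finset.univ.erase i, (1 + s * algebraMap ℝ K (lam j)) ^ m j ≠ 0 :=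
    Finset.prod_ne_zero_iff.2 fun j _ => pow_ne_zero _ (hs j)
  have h2 := hs i
  have h3 : (1 + s * algebraMap ℝ K (lam i)) ^ m i =
      (1 + s * algebraMap ℝ K (lam i)) ^ k * (1 + s * algebraMap ℝ K (lam i)) ^ (m i - k) := by
    rw [← pow_add]; congr 1; omega
  rw [h3]
  field_simp

end

/-! ### The Bessel integral and the K-distribution. -/

theorem integrableOn_rpow_mul_exp_neg_add_div {ν y : ℝ} (hν : -1 < ν) (hy : 0 < y) :
    IntegrableOn (fun t : ℝ => t ^ (ν - 1) * Real.exp (-(t + y / t))) (Set.Ioi 0) := by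
  have h := (integrableOn_rpow_mul_exp_neg_mul_rpow (p := 1) (b := 1) hν one_pos
    one_pos).const_mul y⁻¹
  refine h.mono' (Measurable.aestronglyMeasurable (by fun_prop)) ?_
  filter_upwards [ae_restrict_mem measurableSet_Ioi] with t ht
  have ht : 0 < t := ht
  rw [Real.norm_of_nonneg (by positivity), neg_add, Real.exp_add, Real.rpow_one, neg_one_mul]
  -- This bound gains one power of `t` at the origin, which admits `ν = 0`, the exponent needed for
  -- shape 1.
  have h1 : Real.exp (-(y / t)) ≤ t / y := by
    rw [Real.exp_neg, inv_le_comm₀ (Real.exp_pos _) (by positivity), inv_div]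
    linarith [Real.add_one_le_exp (y / t)]
  calc t ^ (ν - 1) * (Real.exp (-t) * Real.exp (-(y / t)))
      ≤ t ^ (ν - 1) * (Real.exp (-t) * (t / y)) := by gcongr
    _ = y⁻¹ * (t ^ ν * Real.exp (-t)) := by
      rw [Real.rpow_sub_one ht.ne']; field_simp

/-- The substitution `t = √y exp u` symmetrizes `t + y/t` into `2 √y cosh u`; folding the line at `u
= 0` then replaces `exp(ν u)` by `2 cosh(ν u)`. -/
theorem integral_rpow_mul_exp_neg_add_div {ν y : ℝ} (hν : -1 < ν) (hy : 0 < y) :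
    ∫ t in Set.Ioi (0 : ℝ), t ^ (ν - 1) * Real.exp (-(t + y / t)) =
      2 * y ^ (ν / 2) * besselK ν (2 * √y) := by
  have hsy : 0 < √y := Real.sqrt_pos.2 hy
  have himg : (fun u : ℝ => √y * Real.exp u) '' Set.univ = Set.Ioi 0 := by
    ext t
    simp only [Set.image_univ, Set.mem_range, Set.mem_Ioi]
    refine ⟨?_, fun ht => ⟨Real.log (t / √y), ?_⟩⟩
    · rintro ⟨u, rfl⟩; positivity
    · rw [Real.exp_log (by positivity)]; field_simp
  have hder : ∀ u ∈ Set.univ, HasDerivWithinAt (fun u : ℝ => √y * Real.exp u)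
      (√y * Real.exp u) Set.univ u := fun u _ => ((Real.hasDerivAt_exp u).const_mul _).hasDerivWithinAt
  have hinj : Set.InjOn (fun u : ℝ => √y * Real.exp u) Set.univ := by
    intro a _ b _ h
    exact Real.exp_injective (mul_left_cancel₀ hsy.ne' h)
  have hint := integrableOn_rpow_mul_exp_neg_add_div hν hy
  rw [← himg, integrableOn_image_iff_integrableOn_abs_deriv_smul MeasurableSet.univ hder hinj]
    at hint
  rw [← himg, integral_image_eq_integral_abs_deriv_smul MeasurableSet.univ hder hinj]
  have hfun : ∀ u : ℝ, |√y * Real.exp u| • ((√y * Real.exp u) ^ (ν - 1) *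
      Real.exp (-(√y * Real.exp u + y / (√y * Real.exp u)))) =
      y ^ (ν / 2) * (Real.exp (ν * u) * Real.exp (-(2 * √y) * Real.cosh u)) := by
    intro u
    have hp : 0 < √y * Real.exp u := by positivity
    rw [abs_of_pos hp, smul_eq_mul, ← mul_assoc, Real.rpow_sub_one hp.ne',
      mul_div_cancel₀ _ hp.ne', Real.mul_rpow hsy.le (Real.exp_pos u).le, Real.sqrt_eq_rpow,
      ← Real.rpow_mul hy.le, ← Real.exp_mul, ← Real.sqrt_eq_rpow, Real.cosh_eq]
    have h2 : y / (√y * Real.exp u) = √y * Real.exp (-u) := by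
      rw [Real.exp_neg]
      field_simp
      rw [Real.sq_sqrt hy.le]
    rw [h2]
    ring_nf
  simp_rw [hfun] at hint ⊢
  rw [integrableOn_univ] at hint
  rw [setIntegral_univ, ← intervalIntegral.integral_Iic_add_Ioi (b := 0) hint.integrableOn hint.integrableOn]
  have hneg := integral_comp_neg_Ioi (0 : ℝ) (fun u => 
    y ^ (ν / 2) * (Real.exp (ν * u) * Real.exp (-(2 * √y) * Real.cosh u)))
  rw [neg_zero] at hneg
  rw [← hneg, ← integral_add _ hint.integrableOn, besselK, ← integral_const_mul]
  · refine integral_congr_ae (Eventually.of_forall fun u => ?_)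
    simp only [Real.cosh_neg]
    rw [Real.cosh_eq (ν * u), mul_neg]
    ring
  · exact (hint.comp_neg).integrableOn

/-- The K-distribution as a mixture: an exponential of mean `l t`, with `t` distributed as
Gamma(`k`, 1). -/
theorem kPDF_eq {k : ℕ} (hk : 1 ≤ k) {l g : ℝ} (hl : 0 < l) (hg : 0 < g) :
    kPDF k l g = ∫ t in Set.Ioi (0 : ℝ), (Real.Gamma k * l)⁻¹ *
      (t ^ ((k : ℝ) - 2) * Real.exp (-(t + g / l / t))) := by
  have hk' : (1 : ℝ) ≤ k := by exact_mod_cast hk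
  have h := integral_rpow_mul_exp_neg_add_div (ν := k - 1) (y := g / l) (by linarith)
    (by positivity)
  have h2 : (k : ℝ) - 1 - 1 = k - 2 := by ring
  rw [h2] at h
  rw [integral_const_mul, h, kPDF]
  have h3 : l ^ (-((k : ℝ) + 1) / 2) = (l ^ (((k : ℝ) - 1) / 2))⁻¹ * l⁻¹ := by
    rw [← Real.rpow_neg_one l, ← Real.rpow_neg hl.le, ← Real.rpow_add hl]
    congr 1; ring
  rw [Real.div_rpow hg.le hl.le, h3]
  field_simp

theorem integral_Ioc_exp_neg_div {c x : ℝ} (hc : 0 < c) (hx : 0 < x) :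
    ∫ g in Set.Ioc 0 x, Real.exp (-(g / c)) = c * (1 - Real.exp (-(x / c))) := by
  rw [← intervalIntegral.integral_of_le hx.le]
  have : ∀ g ∈ Set.uIcc 0 x, HasDerivAt (fun g => -c * Real.exp (-(g / c)))
      (Real.exp (-(g / c))) g := by
    intro g _
    have := (((hasDerivAt_id g).div_const c).neg.exp).const_mul (-c)
    refine this.congr_deriv ?_
    simp only [id]
    field_simp
    rfl
  rw [intervalIntegral.integral_eq_sub_of_hasDerivAt this
    (Continuous.intervalIntegrable (by fun_prop) _ _)]
  simp; ring

/-- Fubini in the mixture representation: the inner integral is an exponential distribution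
function, bounded by 1, so the Gamma(`k`, 1) density dominates. -/
theorem kCDF_eq_integral {k : ℕ} (hk : 1 ≤ k) {l x : ℝ} (hl : 0 < l) (hx : 0 < x) :
    kCDF k l x = ∫ t in Set.Ioi (0 : ℝ), (Real.Gamma k)⁻¹ *
      (t ^ ((k : ℝ) - 1) * Real.exp (-t) * (1 - Real.exp (-(x / l / t)))) := by
  have hk' : (1 : ℝ) ≤ k := by exact_mod_cast hk
  have hG : 0 < Real.Gamma k := Real.Gamma_pos_of_pos (by linarith)
  have hinner : ∀ t ∈ Set.Ioi (0 : ℝ), ∫ g in Set.Ioc 0 x, (Real.Gamma k * l)⁻¹ *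
      (t ^ ((k : ℝ) - 2) * Real.exp (-(t + g / l / t))) = (Real.Gamma k)⁻¹ *
      (t ^ ((k : ℝ) - 1) * Real.exp (-t) * (1 - Real.exp (-(x / l / t)))) := by
    intro t (ht : 0 < t)
    have : ∀ g, (Real.Gamma k * l)⁻¹ * (t ^ ((k : ℝ) - 2) * Real.exp (-(t + g / l / t))) =
        (Real.Gamma k * l)⁻¹ * (t ^ ((k : ℝ) - 2) * Real.exp (-t)) *
          Real.exp (-(g / (l * t))) := by
      intro g
      rw [neg_add, Real.exp_add, div_div]; ring
    simp_rw [this]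
    rw [integral_const_mul, integral_Ioc_exp_neg_div (by positivity) hx]
    have h2 : t ^ ((k : ℝ) - 1) = t ^ ((k : ℝ) - 2) * t := by
      rw [← Real.rpow_add_one ht.ne']; congr 1; ring
    rw [h2, div_div]
    field_simp
  rw [← setIntegral_congr_fun measurableSet_Ioi hinner, kCDF,
    setIntegral_congr_fun measurableSet_Ioc fun g hg => kPDF_eq hk hl hg.1]
  refine integral_integral_swap ?_
  have hmeas : Measurable (Function.uncurry fun g t : ℝ => (Real.Gamma k * l)⁻¹ *
      (t ^ ((k : ℝ) - 2) * Real.exp (-(t + g / l / t)))) := by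
    unfold Function.uncurry; fun_prop
  rw [integrable_prod_iff' hmeas.aestronglyMeasurable]
  constructor
  · filter_upwards [ae_restrict_mem measurableSet_Ioi] with t ht
    simp only [Function.uncurry]
    exact (Continuous.integrableOn_Icc (by fun_prop)).mono_set Set.Ioc_subset_Icc_self
  · have hI := ((integrableOn_rpow_mul_exp_neg_mul_rpow (p := 1) (b := 1) (s := k - 1)
      (by linarith) one_pos one_pos).const_mul (Real.Gamma k)⁻¹)
    refine hI.mono' hmeas.norm.stronglyMeasurable.integral_prod_left'.aestronglyMeasurable ?_
    filter_upwards [ae_restrict_mem measurableSet_Ioi] with t ht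
    have ht' : 0 < t := ht
    have h1 : ∀ g, ‖(Real.Gamma k * l)⁻¹ * (t ^ ((k : ℝ) - 2) * Real.exp (-(t + g / l / t)))‖ =
        (Real.Gamma k * l)⁻¹ * (t ^ ((k : ℝ) - 2) * Real.exp (-(t + g / l / t))) :=
      fun g => Real.norm_of_nonneg (by positivity)
    simp only [Function.uncurry]
    simp_rw [h1]
    have h2 : Real.exp (-(x / l / t)) ≤ 1 := Real.exp_le_one_iff.2 (by
      rw [neg_nonpos]; positivity)
    rw [hinner t ht, Real.norm_of_nonneg, Real.rpow_one, neg_one_mul]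
    · have h3 := Real.exp_pos (-(x / l / t))
      exact mul_le_mul_of_nonneg_left (mul_le_of_le_one_right (by positivity) (by linarith))
        (by positivity)
    · have : 0 ≤ 1 - Real.exp (-(x / l / t)) := by linarith
      positivity

theorem kCDF_eq_one_sub {k : ℕ} (hk : 1 ≤ k) {l x : ℝ} (hl : 0 < l) (hx : 0 < x) :
    kCDF k l x =
      1 - 2 / Real.Gamma k * (x / l) ^ ((k : ℝ) / 2) * besselK k (2 * √(x / l)) := by
  have hk' : (1 : ℝ) ≤ k := by exact_mod_cast hk
  have hG : 0 < Real.Gamma k := Real.Gamma_pos_of_pos (by linarith)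
  have h := integral_rpow_mul_exp_neg_add_div (ν := k) (y := x / l) (by linarith) (by positivity)
  have h0 : ∀ t : ℝ, t ^ ((k : ℝ) - 1) * Real.exp (-t) * (1 - Real.exp (-(x / l / t))) =
      Real.exp (-t) * t ^ ((k : ℝ) - 1) -
        t ^ ((k : ℝ) - 1) * Real.exp (-(t + x / l / t)) := by
    intro t
    rw [neg_add, Real.exp_add]; ring
  rw [kCDF_eq_integral hk hl hx, integral_const_mul]
  simp_rw [h0]
  rw [integral_sub (Real.GammaIntegral_convergent (by linarith))
    (integrableOn_rpow_mul_exp_neg_add_div (by linarith) (by positivity)), h,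
    ← Real.Gamma_eq_integral (by linarith)]
  field_simp

/-! ### Gamma expectations and signed mixtures. -/

theorem integral_gammaMeasure {a r : ℝ} (ha : 0 < a) (hr : 0 < r) (f : ℝ → ℝ) :
    ∫ t, f t ∂gammaMeasure a r =
      ∫ t in Set.Ioi (0 : ℝ), r ^ a / Real.Gamma a * t ^ (a - 1) * Real.exp (-(r * t)) * f t := by
  rw [gammaMeasure, integral_withDensity_eq_integral_toReal_smul₀
    (by unfold gammaPDF; fun_prop) (by simp [gammaPDF])]
  have h0 : ∀ x, (gammaPDF a r x).toReal = gammaPDFReal a r x := fun x =>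
    ENNReal.toReal_ofReal (gammaPDFReal_nonneg ha hr x)
  simp_rw [h0]
  have h1 : ∀ x, gammaPDFReal a r x • f x = Set.indicator (Set.Ici 0) (fun t =>
      r ^ a / Real.Gamma a * t ^ (a - 1) * Real.exp (-(r * t)) * f t) x := by
    intro x
    rw [gammaPDFReal]
    split_ifs with hx
    · rw [Set.indicator_of_mem (by exact hx), smul_eq_mul]
    · rw [Set.indicator_of_notMem (by exact hx), zero_smul]
  simp_rw [h1]
  rw [integral_indicator measurableSet_Ici, integral_Ici_eq_integral_Ioi]

/-- The scaling `t ↦ l t` reduces this to `kCDF_eq_integral`. The absolute value changes nothing on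
the half-line carrying the gamma law, but it keeps the test function bounded on all of `ℝ`. -/
theorem integral_one_sub_exp_gammaMeasure {k : ℕ} (hk : 1 ≤ k) {l x : ℝ} (hl : 0 < l)
    (hx : 0 < x) :
    ∫ t, (1 - Real.exp (-(x / |t|))) ∂gammaMeasure k l⁻¹ = kCDF k l x := by
  have hk' : (1 : ℝ) ≤ k := by exact_mod_cast hk
  rw [integral_gammaMeasure (by linarith) (by positivity), kCDF_eq_integral hk hl hx]
  rw [setIntegral_congr_fun (g := fun t : ℝ => l⁻¹ ^ (k : ℝ) / Real.Gamma k *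
    t ^ ((k : ℝ) - 1) * Real.exp (-(l⁻¹ * t)) * (1 - Real.exp (-(x / t)))) measurableSet_Ioi
    fun t (ht : 0 < t) => by simp only [abs_of_pos ht]]
  have := integral_comp_mul_left_Ioi (fun t : ℝ => l⁻¹ ^ (k : ℝ) / Real.Gamma k *
    t ^ ((k : ℝ) - 1) * Real.exp (-(l⁻¹ * t)) * (1 - Real.exp (-(x / t)))) 0 hl
  rw [mul_zero] at this
  rw [eq_comm, inv_smul_eq_iff₀ hl.ne'] at this
  rw [this, smul_eq_mul, ← integral_const_mul]
  refine setIntegral_congr_fun measurableSet_Ioi fun t (ht : 0 < t) => ?_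
  rw [Real.mul_rpow hl.le ht.le, Real.inv_rpow hl.le, Real.rpow_sub_one hl.ne', div_div,
    inv_mul_cancel_left₀ hl.ne']
  field_simp

/-- The coefficients may be negative, so the right side is not a measure. Moving the negative parts
to the other side leaves an equality between characteristic functions of finite positive measures,
where uniqueness applies. -/
theorem integral_eq_sum_of_charFun_eq_sum {ι : Type*} [Fintype ι] (c : ι → ℝ) (ν : ι → Measure ℝ)
    [∀ j, IsFiniteMeasure (ν j)] (μ : Measure ℝ) [IsFiniteMeasure μ]
    (h : ∀ t, charFun μ t = ∑ j, (c j : ℂ) * charFun (ν j) t) (f : ℝ → ℝ)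
    (hμ : Integrable f μ) (hν : ∀ j, Integrable f (ν j)) :
    ∫ x, f x ∂μ = ∑ j, c j * ∫ x, f x ∂ν j := by
  have hc : ∀ j, ((c j).toNNReal : ℝ) - ((-c j).toNNReal : ℝ) = c j := fun j => by
    rw [Real.coe_toNNReal', Real.coe_toNNReal', max_zero_sub_max_neg_zero_eq_self]
  have key : μ + ∑ j, (-c j).toNNReal • ν j = ∑ j, (c j).toNNReal • ν j := by
    apply Measure.ext_of_charFun
    ext t
    have hi : ∀ (ρ : Measure ℝ) [IsFiniteMeasure ρ],
        Integrable (fun x : ℝ => Complex.exp (t * x * Complex.I)) ρ := by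
      intro ρ _
      refine Integrable.of_bound (Measurable.aestronglyMeasurable (by fun_prop)) 1
        (Eventually.of_forall fun x => ?_)
      rw [← Complex.ofReal_mul, Complex.norm_exp_ofReal_mul_I]
    have h' := h t
    simp only [charFun_apply_real] at h' ⊢
    rw [integral_add_measure (hi _) (hi _), integral_finsetSum_measure fun j _ => hi _,
      integral_finsetSum_measure fun j _ => hi _, h', ← Finset.sum_add_distrib]
    refine Finset.sum_congr rfl fun j _ => ?_
    rw [integral_smul_nnreal_measure, integral_smul_nnreal_measure, NNReal.smul_def,
      NNReal.smul_def, Complex.real_smul, Complex.real_smul, ← add_mul]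
    congr 1
    rw [← Complex.ofReal_add]
    congr 1
    linarith [hc j]
  have hn : ∀ (b : ι → ℝ≥0), ∀ j ∈ Finset.univ, Integrable f (b j • ν j) :=
    fun b j _ => (hν j).smul_measure_nnreal
  have hI := congrArg (fun ρ => ∫ x, f x ∂ρ) key
  rw [integral_add_measure hμ (integrable_finsetSum_measure.2 (hn _)),
    integral_finsetSum_measure (hn _), integral_finsetSum_measure (hn _)] at hI
  rw [eq_sub_of_add_eq hI, ← Finset.sum_sub_distrib]
  refine Finset.sum_congr rfl fun j _ => ?_
  rw [integral_smul_nnreal_measure, integral_smul_nnreal_measure, NNReal.smul_def,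
    NNReal.smul_def, smul_eq_mul, smul_eq_mul, ← sub_mul, hc]

/-! ### The law of the quadratic form and the gain conditioned on `gu`. -/

/-- The quadratic form `∑ d_l |w_l|²`. -/
noncomputable def weightedNormSq {M : ℕ} (d : Fin M → ℝ) (w : Fin M → ℂ) : ℝ :=
  ∑ l, d l * ‖w l‖ ^ 2

theorem measurable_weightedNormSq {M : ℕ} (d : Fin M → ℝ) : Measurable (weightedNormSq d) := by
  unfold weightedNormSq; fun_prop

theorem weightedNormSq_nonneg {M : ℕ} {d : Fin M → ℝ} (hd : ∀ l, 0 ≤ d l) (w : Fin M → ℂ) :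
    0 ≤ weightedNormSq d w :=
  Finset.sum_nonneg fun l _ => mul_nonneg (hd l) (by positivity)

theorem ae_weightedNormSq_pos {M : ℕ} {d : Fin M → ℝ} (hd : ∀ l, 0 ≤ d l) (hd0 : ∃ l, 0 < d l) :
    ∀ᵐ w ∂cgaussVec M, 0 < weightedNormSq d w := by
  obtain ⟨l, hl⟩ := hd0
  filter_upwards [ae_cgaussVec_ne_zero l] with w hw
  refine Finset.sum_pos' (fun l _ => mul_nonneg (hd l) (by positivity)) ⟨l, Finset.mem_univ _, ?_⟩
  have := norm_pos_iff.2 hw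
  positivity

theorem integral_one_sub_exp_weightedNormSq {M : ℕ} {d : Fin M → ℝ} (hd : ∀ l, 0 ≤ d l)
    {q : ℕ} {lam : Fin q → ℝ} {m : Fin q → ℕ} (hq : 0 < q) (hlam : ∀ i, 0 < lam i)
    (hinj : Function.Injective lam) (hm : ∀ i, 1 ≤ m i)
    (hprod : ∀ z : ℂ, ∏ l, (1 + z * d l)⁻¹ = ∏ i, ((1 + z * lam i) ^ m i)⁻¹)
    {x : ℝ} (hx : 0 < x) :
    ∫ w, (1 - Real.exp (-(x / weightedNormSq d w))) ∂cgaussVec M =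
      ∑ i, ∑ k ∈ Finset.Icc 1 (m i), coeff lam m i k * kCDF k (lam i) x := by
  set S : Finset (Σ _ : Fin q, ℕ) := Finset.univ.sigma fun i => Finset.Icc 1 (m i) with hS
  have hk : ∀ j : S, 1 ≤ j.1.2 := fun j => by
    have := Finset.mem_sigma.1 j.2
    exact (Finset.mem_Icc.1 this.2).1
  have hprob : ∀ j : S, IsProbabilityMeasure (gammaMeasure (j.1.2 : ℝ) (lam j.1.1)⁻¹) := fun j =>
    isProbabilityMeasure_gammaMeasure (by exact_mod_cast hk j) (inv_pos.2 (hlam _))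
  have hmw := measurable_weightedNormSq d
  have := Measure.isProbabilityMeasure_map (μ := cgaussVec M) hmw.aemeasurable
  have hf : ∀ (ρ : Measure ℝ) [IsFiniteMeasure ρ],
      Integrable (fun t : ℝ => 1 - Real.exp (-(x / |t|))) ρ := by
    intro ρ _
    refine Integrable.of_bound (Measurable.aestronglyMeasurable (by fun_prop)) 1
      (Eventually.of_forall fun t => ?_)
    have h1 : Real.exp (-(x / |t|)) ≤ 1 := Real.exp_le_one_iff.2 (by
      rw [neg_nonpos]; positivity)
    rw [Real.norm_of_nonneg (by linarith)]
    linarith [Real.exp_pos (-(x / |t|))]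
  have key := integral_eq_sum_of_charFun_eq_sum (ι := S) (fun j => coeff lam m j.1.1 j.1.2)
    (fun j => gammaMeasure (j.1.2 : ℝ) (lam j.1.1)⁻¹) ((cgaussVec M).map (weightedNormSq d)) ?_
    (fun t => 1 - Real.exp (-(x / |t|))) (hf _) (fun j => hf _)
  · rw [integral_map hmw.aemeasurable (Measurable.aestronglyMeasurable (by fun_prop))] at key
    simp_rw [abs_of_nonneg (weightedNormSq_nonneg hd _)] at key
    rw [key, Finset.sum_congr rfl fun j _ => by
      rw [integral_one_sub_exp_gammaMeasure (hk j) (hlam _) hx],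
      Finset.sum_coe_sort S (fun j => coeff lam m j.1 j.2 * kCDF j.2 (lam j.1) x), hS,
      Finset.sum_sigma]
  · intro t
    -- With `z = -i t` the transform of `Q` is its characteristic function, and the partial fraction
    -- terms are those of the gamma laws of rate `1 / λ_i`.
    have h1 := integral_cgaussVec_cexp_normSq d hd (z := -(t * Complex.I)) (by simp)
    have hs : ∀ i, (1 : ℂ) + -(t * Complex.I) * algebraMap ℝ ℂ (lam i) ≠ 0 := by
      intro i h
      have := congrArg Complex.re h
      simp at this
    have h2 := sum_coeff_mul_inv_pow lam m hq hlam hinj hm (-(t * Complex.I)) hs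
    rw [charFun_apply_real, integral_map hmw.aemeasurable (by fun_prop)]
    have h3 : ∀ j ∈ (Finset.univ : Finset S), ((coeff lam m j.1.1 j.1.2 : ℝ) : ℂ) *
        charFun (gammaMeasure (j.1.2 : ℝ) (lam j.1.1)⁻¹) t = (coeff lam m j.1.1 j.1.2 : ℂ) *
          ((1 + -(t * Complex.I) * lam j.1.1) ^ j.1.2)⁻¹ := by
      intro j _
      rw [charFun_gammaMeasure_nat (hk j) (inv_pos.2 (hlam _))]
      congr 3
      push_cast
      rw [div_inv_eq_mul]; ring
    rw [Finset.sum_congr rfl h3, Finset.sum_coe_sort S (fun j => (coeff lam m j.1 j.2 : ℂ) *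
      ((1 + -(t * Complex.I) * lam j.1) ^ j.2)⁻¹), hS, Finset.sum_sigma]
    simp only [Complex.coe_algebraMap] at h2
    rw [← h2, ← hprod, ← h1]
    refine integral_congr_ae (Eventually.of_forall fun w => ?_)
    simp only [weightedNormSq]
    congr 1
    ring

theorem cgaussVec_real_dotProduct_le {M : ℕ} (v : Fin M → ℂ) {x : ℝ} (hx : 0 < x)
    (hv : 0 < ∑ l, ‖v l‖ ^ 2) :
    (cgaussVec M).real {z | ‖star v ⬝ᵥ z‖ ^ 2 ≤ x} = 1 - Real.exp (-(x / ∑ l, ‖v l‖ ^ 2)) := by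
  have hm : Measurable fun z : Fin M → ℂ => star v ⬝ᵥ z := by
    unfold dotProduct; fun_prop
  have hm' : Measurable fun z : ℂ => (√(∑ l, ‖v l‖ ^ 2) : ℂ) * z := by fun_prop
  have hs : MeasurableSet {y : ℂ | ‖y‖ ^ 2 ≤ x} := measurableSet_le (by fun_prop) (by fun_prop)
  have h := congrArg (fun ρ => ρ.real {y : ℂ | ‖y‖ ^ 2 ≤ x}) (map_dotProduct_cgaussVec v)
  rw [map_measureReal_apply hm hs, map_measureReal_apply hm' hs] at h
  rw [← cgauss_real_normSq_mul_le hv hx]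
  have hset : {z : ℂ | (∑ l, ‖v l‖ ^ 2) * ‖z‖ ^ 2 ≤ x} =
      (fun z : ℂ => (√(∑ l, ‖v l‖ ^ 2) : ℂ) * z) ⁻¹' {y : ℂ | ‖y‖ ^ 2 ≤ x} := by
    ext z
    simp only [Set.mem_preimage, Set.mem_ofPred_eq]
    rw [norm_mul, mul_pow, Complex.norm_real, Real.norm_eq_abs, sq_abs, Real.sq_sqrt hv.le]
  rw [hset, ← h]
  rfl

/-- Condition on the second coordinate `u`: the gain is the squared modulus of the product of `(Aᴴ
u)ᴴ` with a Gaussian vector, hence exponential of mean `‖Aᴴ u‖²`. Diagonalizing `A Aᴴ` makes this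
mean a weighted norm of `Uᴴ u`, which has the same law as `u`. -/
theorem prod_real_gain_le {M : ℕ} (A U : Matrix (Fin M) (Fin M) ℂ) (d : Fin M → ℝ)
    (hd : ∀ l, 0 ≤ d l) (hd0 : ∃ l, 0 < d l) (hU : Uᴴ * U = 1)
    (hA : A * Aᴴ = U * Matrix.diagonal (fun l => (d l : ℂ)) * Uᴴ) {x : ℝ} (hx : 0 < x) :
    ((cgaussVec M).prod (cgaussVec M)).real {p | gain A p.2 p.1 ≤ x} =
      ∫ w, (1 - Real.exp (-(x / weightedNormSq d w))) ∂cgaussVec M := by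
  have hQ : ∀ u : Fin M → ℂ, ∑ l, ‖(Aᴴ *ᵥ u) l‖ ^ 2 = weightedNormSq d (Uᴴ *ᵥ u) := by
    intro u
    have h2 : ∀ b : Fin M → ℂ, ((∑ l, ‖b l‖ ^ 2 : ℝ) : ℂ) = star b ⬝ᵥ b := by
      intro b
      simp [dotProduct, Complex.conj_mul']
    have h3 : ∀ b : Fin M → ℂ, ((weightedNormSq d b : ℝ) : ℂ) =
        star b ⬝ᵥ (Matrix.diagonal (fun l => (d l : ℂ)) *ᵥ b) := by
      intro b
      simp only [weightedNormSq, dotProduct, Matrix.mulVec_diagonal, Pi.star_apply]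
      push_cast
      refine Finset.sum_congr rfl fun l _ => ?_
      rw [← Complex.conj_mul']
      simp; ring
    have h4 : ∀ B : Matrix (Fin M) (Fin M) ℂ, star (Bᴴ *ᵥ u) = star u ᵥ* B := by
      intro B
      rw [Matrix.star_mulVec, Matrix.conjTranspose_conjTranspose]
    rw [← Complex.ofReal_inj, h2, h3, h4, h4, ← Matrix.dotProduct_mulVec,
      ← Matrix.dotProduct_mulVec, Matrix.mulVec_mulVec, Matrix.mulVec_mulVec,
      Matrix.mulVec_mulVec, hA, Matrix.mul_assoc]
  have hmU : Measurable fun z : Fin M → ℂ => Uᴴ *ᵥ z := by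
    unfold Matrix.mulVec dotProduct; fun_prop
  have hmap := map_mulVec_cgaussVec Uᴴ (by rwa [Matrix.conjTranspose_conjTranspose])
  have hmg : Measurable fun p : (Fin M → ℂ) × (Fin M → ℂ) => gain A p.2 p.1 := by
    unfold gain Matrix.mulVec dotProduct
    simp only [Pi.star_apply]
    fun_prop
  have hpos : ∀ᵐ u ∂cgaussVec M, 0 < weightedNormSq d (Uᴴ *ᵥ u) := by
    have := ae_weightedNormSq_pos hd hd0
    rw [← hmap] at this
    exact ae_of_ae_map hmU.aemeasurable this
  have hmw := measurable_weightedNormSq d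
  conv_rhs => rw [← hmap]
  rw [integral_map hmU.aemeasurable (Measurable.aestronglyMeasurable (by fun_prop))]
  have hset : MeasurableSet {p : (Fin M → ℂ) × (Fin M → ℂ) | gain A p.2 p.1 ≤ x} :=
    measurableSet_le hmg measurable_const
  rw [measureReal_def, Measure.prod_apply_symm hset, ← integral_toReal
    (measurable_measure_prodMk_right hset).aemeasurable
    (Eventually.of_forall fun _ => measure_lt_top _ _)]
  refine integral_congr_ae ?_
  filter_upwards [hpos] with u hu
  rw [← hQ] at hu ⊢
  rw [← cgaussVec_real_dotProduct_le _ hx hu, measureReal_def]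
  congr 2
  ext z
  simp only [Set.mem_preimage, Set.mem_ofPred_eq, gain]
  rw [Matrix.star_mulVec, Matrix.conjTranspose_conjTranspose, Matrix.dotProduct_mulVec]

/-! ### Eigenvalues of the Gram matrix and their multiplicities. -/

section

variable {M q : ℕ} {C : Matrix (Fin M) (Fin M) ℂ} {lam : Fin q → ℝ} {m : Fin q → ℕ}

theorem IsPosSpectrum.pos (h : IsPosSpectrum C lam m) (i : Fin q) : 0 < lam i :=
  ((h.mem_iff (lam i)).1 ⟨i, rfl⟩).1

theorem hasEigenvalue_toLin'_iff_isRoot (x : ℂ) :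
    Module.End.HasEigenvalue (Matrix.toLin' C) x ↔ C.charpoly.IsRoot x := by
  rw [Module.End.hasEigenvalue_iff_isRoot_charpoly, Matrix.charpoly_toLin']

theorem IsPosSpectrum.one_le_mult (h : IsPosSpectrum C lam m) (i : Fin q) : 1 ≤ m i := by
  rw [h.mult, Nat.one_le_iff_ne_zero, ← Nat.pos_iff_ne_zero,
    Polynomial.rootMultiplicity_pos (Matrix.charpoly_monic C).ne_zero]
  exact (hasEigenvalue_toLin'_iff_isRoot _).1 ((h.mem_iff (lam i)).1 ⟨i, rfl⟩).2

theorem IsPosSpectrum.mult_eq_card (h : IsPosSpectrum C lam m) (hC : C.IsHermitian) (i : Fin q) :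
    m i = (Finset.univ.filter fun l => hC.eigenvalues l = lam i).card := by
  rw [h.mult, ← Polynomial.count_roots, hC.roots_charpoly_eq_eigenvalues,
    Multiset.count_map, Finset.card_def]
  congr 1
  rw [Finset.filter_val]
  refine Multiset.filter_congr fun l _ => ?_
  simp [eq_comm]

theorem IsPosSpectrum.exists_eq_eigenvalue (h : IsPosSpectrum C lam m) (hC : C.IsHermitian)
    (l : Fin M) (hl : 0 < hC.eigenvalues l) : ∃ i, lam i = hC.eigenvalues l := by
  rw [h.mem_iff, hasEigenvalue_toLin'_iff_isRoot]
  refine ⟨hl, ?_⟩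
  rw [hC.charpoly_eq, Polynomial.IsRoot, Polynomial.eval_prod]
  exact Finset.prod_eq_zero (Finset.mem_univ l) (by simp)

/-- The condition `f 0 = 1` removes the zero eigenvalues, which the positive spectrum does not list.
-/
theorem IsPosSpectrum.prod_eigenvalues {K : Type*} [CommMonoid K] (h : IsPosSpectrum C lam m)
    (hC : C.PosSemidef) (f : ℝ → K) (hf : f 0 = 1) :
    ∏ l, f (hC.isHermitian.eigenvalues l) = ∏ i, f (lam i) ^ m i := by
  have h1 : ∀ l, f (hC.isHermitian.eigenvalues l) =
      ∏ i, if hC.isHermitian.eigenvalues l = lam i then f (lam i) else 1 := by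
    intro l
    rcases (hC.eigenvalues_nonneg l).eq_or_lt with h0 | h0
    · rw [← h0, hf, Finset.prod_eq_one]
      intro i _
      rw [if_neg (h.pos i).ne]
    · obtain ⟨i, hi⟩ := h.exists_eq_eigenvalue hC.isHermitian l h0
      rw [← hi, Finset.prod_eq_single i, if_pos rfl]
      · intro j _ hj
        rw [if_neg fun h' => hj (h.injective h'.symm)]
      · simp
  simp_rw [h1]
  rw [Finset.prod_comm]
  refine Finset.prod_congr rfl fun i _ => ?_
  rw [← Finset.prod_filter, Finset.prod_const, h.mult_eq_card hC.isHermitian]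

theorem exists_eigenvalues_pos (hC : C.PosSemidef) (h0 : C ≠ 0) :
    ∃ l, 0 < hC.isHermitian.eigenvalues l := by
  by_contra! h
  refine h0 ((hC.isHermitian.eigenvalues_eq_zero_iff).1 ?_)
  ext l
  exact le_antisymm (h l) (hC.eigenvalues_nonneg l)

theorem IsPosSpectrum.card_pos (h : IsPosSpectrum C lam m) (hC : C.PosSemidef) (h0 : C ≠ 0) :
    0 < q := by
  obtain ⟨l, hl⟩ := exists_eigenvalues_pos hC h0
  obtain ⟨i, -⟩ := h.exists_eq_eigenvalue hC.isHermitian l hl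
  exact i.pos

theorem exists_unitary_conj_diagonal (hC : C.IsHermitian) :
    ∃ U : Matrix (Fin M) (Fin M) ℂ, Uᴴ * U = 1 ∧
      C = U * Matrix.diagonal (fun l => (hC.eigenvalues l : ℂ)) * Uᴴ := by
  refine ⟨hC.eigenvectorUnitary, ?_, ?_⟩
  · exact Unitary.coe_star_mul_self hC.eigenvectorUnitary
  · conv_lhs => rw [hC.spectral_theorem]
    rw [Unitary.conjStarAlgAut_apply]
    rfl

end

/-! ### Linear asymptotics when the rank is at least two. -/

/-- `x⁻¹ E[1 - exp (-x / Q)] → E[1 / Q]` as `x → 0+`. -/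
theorem tendsto_integral_one_sub_exp_div {Ω : Type*} [MeasurableSpace Ω] {μ : Measure Ω}
    {Q : Ω → ℝ} (hQm : Measurable Q) (hQ : ∀ᵐ w ∂μ, 0 < Q w)
    (hi : Integrable (fun w => (Q w)⁻¹) μ) :
    Tendsto (fun x : ℝ => (∫ w, (1 - Real.exp (-(x / Q w))) ∂μ) / x) (𝓝[>] 0)
      (𝓝 (∫ w, (Q w)⁻¹ ∂μ)) := by
  simp_rw [← integral_div]
  -- Domination by `1 / Q` comes from `1 - exp(-v) ≤ v`; the pointwise limit is a derivative at 0.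
  refine tendsto_integral_filter_of_dominated_convergence (fun w => (Q w)⁻¹)
    (Eventually.of_forall fun x => Measurable.aestronglyMeasurable (by fun_prop)) ?_ hi ?_
  · filter_upwards [self_mem_nhdsWithin] with x (hx : 0 < x)
    filter_upwards [hQ] with w hw
    have h1 : Real.exp (-(x / Q w)) ≤ 1 := Real.exp_le_one_iff.2 (by
      rw [neg_nonpos]; positivity)
    have h2 := Real.add_one_le_exp (-(x / Q w))
    rw [Real.norm_of_nonneg (div_nonneg (by linarith) hx.le), div_le_iff₀ hx, inv_mul_eq_div]
    linarith
  · filter_upwards [hQ] with w hw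
    have hd : HasDerivAt (fun x : ℝ => 1 - Real.exp (-(x / Q w))) (Q w)⁻¹ 0 := by
      have := (((hasDerivAt_id (0 : ℝ)).div_const (Q w)).fun_neg.exp).const_sub 1
      refine this.congr_deriv ?_
      simp
    have := hd.tendsto_slope_zero_right
    simpa [div_eq_inv_mul] using this

/-- `E[1 / Q]` is the integral of the Laplace transform of `Q`. -/
theorem integrable_inv_of_laplace {Ω : Type*} [MeasurableSpace Ω] {μ : Measure Ω}
    [IsProbabilityMeasure μ] {Q : Ω → ℝ} (hQm : Measurable Q) (hQ : ∀ᵐ w ∂μ, 0 < Q w)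
    {φ : ℝ → ℝ} (hφ : ∀ s, 0 < s → ∫ w, Real.exp (-(s * Q w)) ∂μ = φ s)
    (hi : IntegrableOn φ (Set.Ioi 0)) :
    Integrable (fun w => (Q w)⁻¹) μ ∧ ∫ w, (Q w)⁻¹ ∂μ = ∫ s in Set.Ioi 0, φ s := by
  have hmeas : Measurable (Function.uncurry fun (s : ℝ) (w : Ω) => Real.exp (-(s * Q w))) := by
    unfold Function.uncurry; fun_prop
  have hprod : Integrable (Function.uncurry fun (s : ℝ) (w : Ω) => Real.exp (-(s * Q w)))
      ((volume.restrict (Set.Ioi 0)).prod μ) := by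
    rw [integrable_prod_iff hmeas.aestronglyMeasurable]
    constructor
    · filter_upwards [ae_restrict_mem measurableSet_Ioi] with s (hs : 0 < s)
      refine Integrable.of_bound (Measurable.aestronglyMeasurable (by
        simp only [Function.uncurry]; fun_prop)) 1 ?_
      filter_upwards [hQ] with w hw
      simp only [Function.uncurry]
      rw [Real.norm_of_nonneg (Real.exp_pos _).le, Real.exp_le_one_iff, neg_nonpos]
      positivity
    · refine hi.congr ?_
      filter_upwards [ae_restrict_mem measurableSet_Ioi] with s (hs : 0 < s)
      rw [← hφ s hs]
      refine integral_congr_ae (Eventually.of_forall fun w => ?_)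
      exact (Real.norm_of_nonneg (Real.exp_pos _).le).symm
  have hinner : ∀ᵐ w ∂μ, ∫ s in Set.Ioi (0 : ℝ), Real.exp (-(s * Q w)) = (Q w)⁻¹ := by
    filter_upwards [hQ] with w hw
    have := integral_exp_mul_Ioi (a := -Q w) (by linarith) 0
    simp only [mul_zero, Real.exp_zero] at this
    rw [neg_div_neg_eq, one_div] at this
    rw [← this]
    congr 1; ext s; ring_nf
  have hright := hprod.integral_prod_right
  refine ⟨hright.congr hinner, ?_⟩
  rw [← integral_congr_ae hinner, ← integral_integral_swap hprod]
  exact setIntegral_congr_fun measurableSet_Ioi fun s hs => hφ s hs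

theorem Icc_one_eq_insert {n : ℕ} (hn : 1 ≤ n) :
    Finset.Icc 1 n = insert 1 (Finset.Icc 2 n) := by
  ext k; simp; omega

section

variable {q : ℕ} (lam : Fin q → ℝ) (m : Fin q → ℕ)

theorem tendsto_mul_inv_one_add_mul {l : ℝ} (hl : 0 < l) :
    Tendsto (fun s : ℝ => s * (1 + s * l)⁻¹) atTop (𝓝 l⁻¹) := by
  have h : Tendsto (fun s : ℝ => (s⁻¹ + l)⁻¹) atTop (𝓝 (0 + l)⁻¹) :=
    (tendsto_inv_atTop_zero.add_const l).inv₀ (by simpa using hl.ne')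
  rw [zero_add] at h
  refine h.congr' ?_
  filter_upwards [eventually_gt_atTop 0] with s hs
  field_simp

theorem tendsto_inv_one_add_mul {l : ℝ} (hl : 0 < l) :
    Tendsto (fun s : ℝ => (1 + s * l)⁻¹) atTop (𝓝 0) :=
  tendsto_inv_atTop_zero.comp
    (tendsto_atTop_add_const_left _ _ (tendsto_id.atTop_mul_const hl))

/-- Multiply the partial fraction identity by `s` and let `s → ∞`: the product decays at least like
`s⁻²`, so that side tends to 0, while in the sum only the terms `k = 1` survive and give `S₁`. -/
theorem S₁_eq_zero (hq : 0 < q) (hlam : ∀ i, 0 < lam i) (hinj : Function.Injective lam)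
    (hm : ∀ i, 1 ≤ m i) (h2 : 2 ≤ ∑ i, m i) : S₁ lam m = 0 := by
  -- The smallest eigenvalue bounds the whole product of denominators below by `(1 + s λ)²`.
  obtain ⟨i₀, -, hi₀⟩ := Finset.exists_min_image Finset.univ lam ⟨⟨0, hq⟩, Finset.mem_univ _⟩
  have hlhs : Tendsto (fun s : ℝ => s * ∏ i, ((1 + s * lam i) ^ m i)⁻¹) atTop (𝓝 0) := by
    have hup := (tendsto_mul_inv_one_add_mul (hlam i₀)).mul (tendsto_inv_one_add_mul (hlam i₀))
    rw [mul_zero] at hup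
    refine squeeze_zero' ?_ ?_ hup
    · filter_upwards [eventually_ge_atTop 0] with s hs
      have : ∀ i, 0 < 1 + s * lam i := fun i => by have := hlam i; positivity
      exact mul_nonneg hs (Finset.prod_nonneg fun i _ => by have := this i; positivity)
    · filter_upwards [eventually_ge_atTop 0] with s hs
      have hpos : 0 < 1 + s * lam i₀ := by have := hlam i₀; positivity
      rw [mul_assoc]
      refine mul_le_mul_of_nonneg_left ?_ hs
      rw [Finset.prod_inv_distrib, ← mul_inv]
      refine inv_anti₀ (by positivity) ?_
      calc (1 + s * lam i₀) * (1 + s * lam i₀) = (1 + s * lam i₀) ^ 2 := by ring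
        _ ≤ (1 + s * lam i₀) ^ ∑ i, m i := by
          refine pow_le_pow_right₀ ?_ h2
          have := mul_nonneg hs (hlam i₀).le
          linarith
        _ = ∏ i, (1 + s * lam i₀) ^ m i := (Finset.prod_pow_eq_pow_sum _ _ _).symm
        _ ≤ ∏ i, (1 + s * lam i) ^ m i := by
          refine Finset.prod_le_prod (fun i _ => by positivity) fun i _ => ?_
          have := hi₀ i (Finset.mem_univ _)
          gcongr
  have hrhs : Tendsto (fun s : ℝ => s * ∑ i, ∑ k ∈ Finset.Icc 1 (m i), coeff lam m i k *
      ((1 + s * lam i) ^ k)⁻¹) atTop (𝓝 (S₁ lam m)) := by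
    simp_rw [Finset.mul_sum]
    refine tendsto_finsetSum _ fun i _ => ?_
    rw [Icc_one_eq_insert (hm i)]
    have e : ∀ s : ℝ, ∑ k ∈ insert 1 (Finset.Icc 2 (m i)), s * (coeff lam m i k *
        ((1 + s * lam i) ^ k)⁻¹) = coeff lam m i 1 * (s * (1 + s * lam i)⁻¹) +
        ∑ k ∈ Finset.Icc 2 (m i), coeff lam m i k * ((s * (1 + s * lam i)⁻¹) *
          ((1 + s * lam i)⁻¹) ^ (k - 1)) := by
      intro s
      rw [Finset.sum_insert (by simp)]
      congr 1
      · rw [pow_one]; ring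
      · refine Finset.sum_congr rfl fun k hk => ?_
        obtain ⟨n, rfl⟩ : ∃ n, k = n + 1 := ⟨k - 1, by have := (Finset.mem_Icc.1 hk).1; omega⟩
        rw [Nat.add_sub_cancel, ← inv_pow, pow_succ]; ring
    simp_rw [e]
    have h1 := (tendsto_mul_inv_one_add_mul (hlam i)).const_mul (coeff lam m i 1)
    have h3 : Tendsto (fun s : ℝ => ∑ k ∈ Finset.Icc 2 (m i), coeff lam m i k *
        ((s * (1 + s * lam i)⁻¹) * ((1 + s * lam i)⁻¹) ^ (k - 1))) atTop
        (𝓝 (∑ k ∈ Finset.Icc 2 (m i), 0)) := by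
      refine tendsto_finsetSum _ fun k hk => ?_
      have := ((tendsto_mul_inv_one_add_mul (hlam i)).mul
        ((tendsto_inv_one_add_mul (hlam i)).pow (k - 1))).const_mul (coeff lam m i k)
      rwa [zero_pow (by have := (Finset.mem_Icc.1 hk).1; omega), mul_zero, mul_zero] at this
    simpa [div_eq_mul_inv] using h1.add h3
  refine tendsto_nhds_unique hrhs (hlhs.congr' ?_)
  filter_upwards [eventually_ge_atTop 0] with s hs
  congr 1
  exact sum_coeff_mul_inv_pow lam m hq hlam hinj hm s fun i => by
    have := mul_nonneg hs (hlam i).le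
    simp only [Algebra.algebraMap_self, RingHom.id_apply]
    positivity

/-- Termwise integration of the partial fractions gives the antiderivative `G`, with logarithms from
`k = 1` and powers from `k ≥ 2`. It satisfies `G 0 = -S₃` and tends to `S₂` at infinity. -/
theorem integral_prod_inv_pow (hq : 0 < q) (hlam : ∀ i, 0 < lam i)
    (hinj : Function.Injective lam) (hm : ∀ i, 1 ≤ m i) (h2 : 2 ≤ ∑ i, m i) :
    IntegrableOn (fun s : ℝ => ∏ i, ((1 + s * lam i) ^ m i)⁻¹) (Set.Ioi 0) ∧
      ∫ s in Set.Ioi (0 : ℝ), ∏ i, ((1 + s * lam i) ^ m i)⁻¹ = S₂ lam m + S₃ lam m := by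
  set G : ℝ → ℝ := fun s => ∑ i, (coeff lam m i 1 / lam i * Real.log (1 + s * lam i) -
    ∑ k ∈ Finset.Icc 2 (m i), coeff lam m i k / (((k : ℝ) - 1) * lam i) *
      ((1 + s * lam i) ^ (k - 1))⁻¹) with hG
  have hpos : ∀ s, 0 ≤ s → ∀ i, 0 < 1 + s * lam i := fun s hs i => by
    have := hlam i; positivity
  have hder : ∀ s, 0 ≤ s → HasDerivAt G (∏ i, ((1 + s * lam i) ^ m i)⁻¹) s := by
    intro s hs
    rw [show ∏ i, ((1 + s * lam i) ^ m i)⁻¹ = _ from sum_coeff_mul_inv_pow lam m hq hlam hinj hm s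
      fun i => (hpos s hs i).ne']
    refine HasDerivAt.fun_sum fun i _ => ?_
    have hp := hpos s hs i
    have hl := hlam i
    have hlin : HasDerivAt (fun s : ℝ => 1 + s * lam i) (lam i) s := by
      simpa using ((hasDerivAt_id s).mul_const (lam i)).const_add 1
    rw [Icc_one_eq_insert (hm i), Finset.sum_insert (by simp)]
    have h1 := (hlin.log hp.ne').const_mul (coeff lam m i 1 / lam i)
    have h3 : HasDerivAt (fun s : ℝ => ∑ k ∈ Finset.Icc 2 (m i),
        coeff lam m i k / (((k : ℝ) - 1) * lam i) * ((1 + s * lam i) ^ (k - 1))⁻¹)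
        (∑ k ∈ Finset.Icc 2 (m i), -(coeff lam m i k * ((1 + s * lam i) ^ k)⁻¹)) s := by
      refine HasDerivAt.fun_sum fun k hk => ?_
      obtain ⟨n, rfl⟩ : ∃ n, k = n + 2 := ⟨k - 2, by have := (Finset.mem_Icc.1 hk).1; omega⟩
      have := ((hlin.fun_pow (n + 1)).fun_inv (pow_ne_zero _ hp.ne')).const_mul
        (coeff lam m i (n + 2) / ((((n + 2 : ℕ) : ℝ) - 1) * lam i))
      refine this.congr_deriv ?_
      have hn : ((n + 2 : ℕ) : ℝ) - 1 = n + 1 := by push_cast; ring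
      have hn0 : (n : ℝ) + 1 ≠ 0 := by positivity
      rw [hn, Nat.add_sub_cancel]
      push_cast
      field_simp
      ring
    refine (h1.fun_sub h3).congr_deriv ?_
    rw [Finset.sum_neg_distrib, sub_neg_eq_add]
    simp only [Algebra.algebraMap_self, RingHom.id_apply, pow_one]
    congr 1
    field_simp
  have hlim : Tendsto G atTop (𝓝 (S₂ lam m)) := by
    have hS := S₁_eq_zero lam m hq hlam hinj hm h2
    have e : ∀ᶠ s : ℝ in atTop, ∑ i, (coeff lam m i 1 / lam i * Real.log (s⁻¹ + lam i) -
        ∑ k ∈ Finset.Icc 2 (m i), coeff lam m i k / (((k : ℝ) - 1) * lam i) *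
          ((1 + s * lam i)⁻¹) ^ (k - 1)) = G s := by
      filter_upwards [eventually_gt_atTop 0] with s hs
      -- Subtracting this vanishing term turns each `log(1 + s λ_i)` into `log(s⁻¹ + λ_i)`, which
      -- converges.
      have : G s = G s - S₁ lam m * Real.log s := by rw [hS]; ring
      rw [this, hG, S₁, Finset.sum_mul]
      simp only
      rw [← Finset.sum_sub_distrib]
      refine Finset.sum_congr rfl fun i _ => ?_
      have hl : s⁻¹ + lam i = (1 + s * lam i) / s := by field_simp
      rw [hl, Real.log_div (hpos s hs.le i).ne' hs.ne']
      simp_rw [inv_pow]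
      ring
    refine Tendsto.congr' e ?_
    refine tendsto_finsetSum _ fun i _ => ?_
    have h1 : Tendsto (fun s : ℝ => coeff lam m i 1 / lam i * Real.log (s⁻¹ + lam i)) atTop
        (𝓝 (coeff lam m i 1 / lam i * Real.log (0 + lam i))) :=
      ((tendsto_inv_atTop_zero.add_const (lam i)).log (by simpa using (hlam i).ne')).const_mul _
    have h3 : Tendsto (fun s : ℝ => ∑ k ∈ Finset.Icc 2 (m i),
        coeff lam m i k / (((k : ℝ) - 1) * lam i) * ((1 + s * lam i)⁻¹) ^ (k - 1)) atTop
        (𝓝 (∑ k ∈ Finset.Icc 2 (m i), 0)) := by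
      refine tendsto_finsetSum _ fun k hk => ?_
      have := ((tendsto_inv_one_add_mul (hlam i)).pow (k - 1)).const_mul
        (coeff lam m i k / (((k : ℝ) - 1) * lam i))
      rwa [zero_pow (by have := (Finset.mem_Icc.1 hk).1; omega), mul_zero] at this
    have := h1.sub h3
    rwa [zero_add, Finset.sum_const_zero, sub_zero, div_mul_eq_mul_div] at this
  have hcont := (hder 0 le_rfl).continuousAt.continuousWithinAt (s := Set.Ici 0)
  have hnn : ∀ s ∈ Set.Ioi (0 : ℝ), 0 ≤ ∏ i, ((1 + s * lam i) ^ m i)⁻¹ := fun s hs =>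
    Finset.prod_nonneg fun i _ => by have := hpos s (le_of_lt hs) i; positivity
  have hd' : ∀ s ∈ Set.Ioi (0 : ℝ), HasDerivAt G (∏ i, ((1 + s * lam i) ^ m i)⁻¹) s :=
    fun s hs => hder s (le_of_lt hs)
  refine ⟨integrableOn_Ioi_deriv_of_nonneg hcont hd' hnn hlim, ?_⟩
  rw [integral_Ioi_of_hasDerivAt_of_nonneg hcont hd' hnn hlim]
  simp [hG, S₃]

theorem S₂_add_S₃_pos (hq : 0 < q) (hlam : ∀ i, 0 < lam i)
    (hinj : Function.Injective lam) (hm : ∀ i, 1 ≤ m i) (h2 : 2 ≤ ∑ i, m i) :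
    0 < S₂ lam m + S₃ lam m := by
  obtain ⟨h1, h3⟩ := integral_prod_inv_pow lam m hq hlam hinj hm h2
  have hpos : ∀ s ∈ Set.Ioi (0 : ℝ), 0 < ∏ i, ((1 + s * lam i) ^ m i)⁻¹ := fun s hs =>
    Finset.prod_pos fun i _ => by
      have := hlam i
      have hs : 0 < s := hs
      positivity
  rw [← h3, setIntegral_pos_iff_support_of_nonneg_ae _ h1]
  · have hsub : Set.Ioi (0 : ℝ) ⊆ Function.support fun s : ℝ => ∏ i, ((1 + s * lam i) ^ m i)⁻¹ :=
      fun s hs => (hpos s hs).ne'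
    rw [Set.inter_eq_right.2 hsub]
    simp
  · filter_upwards [ae_restrict_mem measurableSet_Ioi] with s hs using (hpos s hs).le

end

/-! ### The logarithmic asymptotics in rank one. -/

theorem integrableOn_exp_neg_mul_one_sub {y : ℝ} (hy : 0 < y) :
    IntegrableOn (fun t : ℝ => Real.exp (-t) * (1 - Real.exp (-(y / t)))) (Set.Ioi 0) := by
  refine (integrableOn_exp_neg_Ioi 0).mono' (Measurable.aestronglyMeasurable (by fun_prop)) ?_
  filter_upwards [ae_restrict_mem measurableSet_Ioi] with t (ht : 0 < t)
  have h1 : Real.exp (-(y / t)) ≤ 1 := Real.exp_le_one_iff.2 (by rw [neg_nonpos]; positivity)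
  have h2 := Real.exp_pos (-(y / t))
  rw [Real.norm_of_nonneg (mul_nonneg (Real.exp_pos _).le (by linarith))]
  exact mul_le_of_le_one_right (Real.exp_pos _).le (by linarith)

/-- Split at `y` and `1` and bound the integrand by `1`, `y / t` and `y exp(-t)` on the three
pieces; the middle one produces the logarithm. -/
theorem integral_exp_neg_mul_one_sub_le {y : ℝ} (hy : 0 < y) (hy1 : y < 1) :
    ∫ t in Set.Ioi (0 : ℝ), Real.exp (-t) * (1 - Real.exp (-(y / t))) ≤
      y * (-Real.log y) + 2 * y := by
  have hI := integrableOn_exp_neg_mul_one_sub hy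
  have hb : ∀ t, 0 < t → 1 - Real.exp (-(y / t)) ≤ 1 ∧ 1 - Real.exp (-(y / t)) ≤ y / t := by
    intro t ht
    have h1 := Real.exp_pos (-(y / t))
    have h2 := Real.add_one_le_exp (-(y / t))
    constructor <;> linarith
  have hsplit : Set.Ioi (0 : ℝ) = Set.Ioc 0 y ∪ (Set.Ioc y 1 ∪ Set.Ioi 1) := by
    rw [Set.Ioc_union_Ioi_eq_Ioi hy1.le, Set.Ioc_union_Ioi_eq_Ioi hy.le]
  have h1 : ∫ t in Set.Ioc 0 y, Real.exp (-t) * (1 - Real.exp (-(y / t))) ≤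
      ∫ t in Set.Ioc 0 y, (1 : ℝ) := by
    refine setIntegral_mono_on (hI.mono_set Set.Ioc_subset_Ioi_self) (by simp) measurableSet_Ioc
      fun t ht => ?_
    have h3 : Real.exp (-t) ≤ 1 := Real.exp_le_one_iff.2 (by linarith [ht.1])
    calc _ ≤ Real.exp (-t) * 1 := by gcongr; exact (hb t ht.1).1
      _ ≤ 1 := by linarith
  have hinv : IntegrableOn (fun t : ℝ => y / t) (Set.Ioc y 1) := by
    refine (ContinuousOn.integrableOn_Icc ?_).mono_set Set.Ioc_subset_Icc_self
    exact continuousOn_const.div continuousOn_id fun t ht => (hy.trans_le ht.1).ne'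
  have h2 : ∫ t in Set.Ioc y 1, Real.exp (-t) * (1 - Real.exp (-(y / t))) ≤
      ∫ t in Set.Ioc y 1, y / t := by
    refine setIntegral_mono_on
      (hI.mono_set fun t ht => Set.mem_Ioi.2 (hy.trans ht.1)) hinv measurableSet_Ioc fun t ht => ?_
    have ht0 : 0 < t := hy.trans ht.1
    have h3 : Real.exp (-t) ≤ 1 := Real.exp_le_one_iff.2 (by linarith)
    calc _ ≤ Real.exp (-t) * (y / t) := by gcongr; exact (hb t ht0).2
      _ ≤ y / t := mul_le_of_le_one_left (by positivity) h3
  have h3 : ∫ t in Set.Ioi 1, Real.exp (-t) * (1 - Real.exp (-(y / t))) ≤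
      ∫ t in Set.Ioi 1, y * Real.exp (-t) := by
    refine setIntegral_mono_on (hI.mono_set (Set.Ioi_subset_Ioi zero_le_one))
      ((integrableOn_exp_neg_Ioi 1).const_mul y) measurableSet_Ioi fun t (ht : 1 < t) => ?_
    have h4 : y / t ≤ y := div_le_self hy.le ht.le
    rw [mul_comm]
    gcongr
    exact (hb t (by linarith)).2.trans h4
  have e1 : ∫ t in Set.Ioc 0 y, (1 : ℝ) = y := by simp [hy.le]
  have e2 : ∫ t in Set.Ioc y 1, y / t = y * (-Real.log y) := by
    simp_rw [div_eq_mul_inv]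
    rw [integral_const_mul, ← intervalIntegral.integral_of_le hy1.le,
      integral_inv_of_pos hy one_pos, one_div, Real.log_inv]
  have e3 : ∫ t in Set.Ioi 1, y * Real.exp (-t) ≤ y := by
    rw [integral_const_mul, integral_exp_neg_Ioi]
    exact mul_le_of_le_one_right hy.le (Real.exp_le_one_iff.2 (by norm_num))
  have d1 : Disjoint (Set.Ioc y 1) (Set.Ioi (1 : ℝ)) :=
    Set.disjoint_left.2 fun t h1 h2 => not_lt.2 h1.2 h2
  have d2 : Disjoint (Set.Ioc 0 y) (Set.Ioc y 1 ∪ Set.Ioi (1 : ℝ)) := by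
    rw [Set.Ioc_union_Ioi_eq_Ioi hy1.le]
    exact Set.disjoint_left.2 fun t h1 h2 => not_lt.2 h1.2 h2
  rw [hsplit] at hI ⊢
  have hI' := hI.mono_set Set.subset_union_right
  rw [setIntegral_union d2 (by measurability) (hI.mono_set Set.subset_union_left) hI',
    setIntegral_union d1 (by measurability) (hI'.mono_set Set.subset_union_left)
      (hI'.mono_set Set.subset_union_right)]
  linarith

/-- Only `(y, 1]` is kept. With `v = y / t ≤ 1`, the bounds `exp(-t) ≥ 1 - t` and `1 - exp(-v) ≥ v -
v²` give an integrand at least `v - v² - y`, whose integral is `y log(1/y) - 2y + 2y²`. -/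
theorem le_integral_exp_neg_mul_one_sub {y : ℝ} (hy : 0 < y) (hy1 : y < 1) :
    y * (-Real.log y) - 2 * y ≤
      ∫ t in Set.Ioi (0 : ℝ), Real.exp (-t) * (1 - Real.exp (-(y / t))) := by
  have hI := integrableOn_exp_neg_mul_one_sub hy
  have hsub : Set.Ioc y 1 ⊆ Set.Ioi 0 := fun t ht => Set.mem_Ioi.2 (hy.trans ht.1)
  have h1 : ∫ t in Set.Ioc y 1, Real.exp (-t) * (1 - Real.exp (-(y / t))) ≤
      ∫ t in Set.Ioi (0 : ℝ), Real.exp (-t) * (1 - Real.exp (-(y / t))) := by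
    refine setIntegral_mono_set hI ?_ hsub.eventuallyLE
    filter_upwards [ae_restrict_mem measurableSet_Ioi] with t (ht : 0 < t)
    have h1 : Real.exp (-(y / t)) ≤ 1 := Real.exp_le_one_iff.2 (by rw [neg_nonpos]; positivity)
    exact mul_nonneg (Real.exp_pos _).le (by simpa using h1)
  have hder : ∀ t ∈ Set.uIcc y 1, HasDerivAt (fun t : ℝ => y * Real.log t + y ^ 2 * t⁻¹ - y * t)
      (y / t - y ^ 2 / t ^ 2 - y) t := by
    intro t ht
    rw [Set.uIcc_of_le hy1.le] at ht
    have ht0 : t ≠ 0 := (hy.trans_le ht.1).ne'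
    have := (((Real.hasDerivAt_log ht0).const_mul y).add
      ((hasDerivAt_inv ht0).const_mul (y ^ 2))).sub ((hasDerivAt_id t).const_mul y)
    refine this.congr_deriv ?_
    field_simp
    ring
  have hcont : ContinuousOn (fun t : ℝ => y / t - y ^ 2 / t ^ 2 - y) (Set.Icc y 1) := by
    have h0 : ∀ t ∈ Set.Icc y 1, t ≠ 0 := fun t ht => (hy.trans_le ht.1).ne'
    exact ((continuousOn_const.div continuousOn_id h0).sub
      (continuousOn_const.div (continuousOn_id.pow 2) fun t ht => pow_ne_zero 2 (h0 t ht))).sub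
      continuousOn_const
  have h2 : ∫ t in Set.Ioc y 1, (y / t - y ^ 2 / t ^ 2 - y) ≤
      ∫ t in Set.Ioc y 1, Real.exp (-t) * (1 - Real.exp (-(y / t))) := by
    refine setIntegral_mono_on (hcont.integrableOn_Icc.mono_set Set.Ioc_subset_Icc_self)
      (hI.mono_set hsub) measurableSet_Ioc fun t ht => ?_
    have ht0 : 0 < t := hy.trans ht.1
    set v := y / t with hv
    have hv0 : 0 < v := by positivity
    have hv1 : v ≤ 1 := (div_le_one ht0).2 ht.1.le
    have e1 : 1 - t ≤ Real.exp (-t) := by linarith [Real.add_one_le_exp (-t)]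
    have e2 : v - v ^ 2 ≤ 1 - Real.exp (-v) := by
      have h3 : Real.exp (-v) ≤ (1 + v)⁻¹ := by
        rw [Real.exp_neg]
        exact inv_anti₀ (by linarith) (by linarith [Real.add_one_le_exp v])
      have h4 : (1 + v)⁻¹ ≤ 1 - v + v ^ 2 := by
        rw [inv_le_iff_one_le_mul₀ (by linarith)]
        nlinarith [pow_pos hv0 3]
      linarith
    have e3 : y = t * v := by rw [hv]; field_simp
    have e4 : y ^ 2 / t ^ 2 = v ^ 2 := by rw [hv, div_pow]
    have e5 : 0 ≤ v - v ^ 2 := by nlinarith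
    calc v - y ^ 2 / t ^ 2 - y = v - v ^ 2 - t * v := by rw [e4, ← e3]
      _ ≤ (1 - t) * (v - v ^ 2) := by nlinarith [pow_pos hv0 2]
      _ ≤ Real.exp (-t) * (1 - Real.exp (-v)) := by
        exact mul_le_mul e1 e2 e5 (Real.exp_pos _).le
  have h3 : ∫ t in Set.Ioc y 1, (y / t - y ^ 2 / t ^ 2 - y) = y * (-Real.log y) + y ^ 2 - y
      - y + y ^ 2 := by
    rw [← intervalIntegral.integral_of_le hy1.le,
      intervalIntegral.integral_eq_sub_of_hasDerivAt hder
        (ContinuousOn.intervalIntegrable (by rwa [Set.uIcc_of_le hy1.le]))]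
    rw [Real.log_one]
    field_simp
    ring
  nlinarith

theorem kCDF_one_eq {l x : ℝ} (hl : 0 < l) (hx : 0 < x) :
    kCDF 1 l x = ∫ t in Set.Ioi (0 : ℝ), Real.exp (-t) * (1 - Real.exp (-(x / l / t))) := by
  rw [kCDF_eq_integral le_rfl hl hx]
  simp

/-- The two bounds differ from `y log(1/y)` by `O(y)`, which is negligible in the ratio. The summand
`log l / l` in the denominator is what `y = x / l` contributes to `log(1/y)`. -/
theorem tendsto_kCDF_one_div {l : ℝ} (hl : 0 < l) :
    Tendsto (fun x : ℝ => kCDF 1 l x / (x * (-(1 / l) * Real.log x + Real.log l / l))) (𝓝[>] 0)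
      (𝓝 1) := by
  have hlog : Tendsto (fun y : ℝ => (-Real.log y)⁻¹) (𝓝[>] 0) (𝓝 0) :=
    tendsto_inv_atTop_zero.comp (tendsto_neg_atBot_atTop.comp Real.tendsto_log_nhdsGT_zero)
  have key : Tendsto (fun y : ℝ =>
      (∫ t in Set.Ioi (0 : ℝ), Real.exp (-t) * (1 - Real.exp (-(y / t)))) / (y * (-Real.log y)))
      (𝓝[>] 0) (𝓝 1) := by
    have hlo : Tendsto (fun y : ℝ => 1 - 2 * (-Real.log y)⁻¹) (𝓝[>] 0) (𝓝 1) := by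
      simpa using (hlog.const_mul 2).const_sub 1
    have hup : Tendsto (fun y : ℝ => 1 + 2 * (-Real.log y)⁻¹) (𝓝[>] 0) (𝓝 1) := by
      simpa using (hlog.const_mul 2).const_add 1
    have hev : ∀ᶠ y : ℝ in 𝓝[>] 0, 0 < y ∧ y < 1 := Ioo_mem_nhdsGT one_pos
    refine tendsto_of_tendsto_of_tendsto_of_le_of_le' hlo hup ?_ ?_
    · filter_upwards [hev] with y ⟨hy, hy1⟩
      have hL : 0 < -Real.log y := neg_pos.2 (Real.log_neg hy hy1)
      rw [le_div_iff₀ (by positivity)]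
      refine le_trans (le_of_eq ?_) (le_integral_exp_neg_mul_one_sub hy hy1)
      generalize -Real.log y = L at hL ⊢
      field_simp
    · filter_upwards [hev] with y ⟨hy, hy1⟩
      have hL : 0 < -Real.log y := neg_pos.2 (Real.log_neg hy hy1)
      rw [div_le_iff₀ (by positivity)]
      refine le_trans (integral_exp_neg_mul_one_sub_le hy hy1) (le_of_eq ?_)
      generalize -Real.log y = L at hL ⊢
      field_simp
  have hscale : Tendsto (fun x : ℝ => x / l) (𝓝[>] 0) (𝓝[>] 0) := by
    refine tendsto_nhdsWithin_iff.2 ⟨?_, ?_⟩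
    · have : Tendsto (fun x : ℝ => x / l) (𝓝 0) (𝓝 (0 / l)) := tendsto_id.div_const l
      rw [zero_div] at this
      exact this.mono_left nhdsWithin_le_nhds
    · filter_upwards [self_mem_nhdsWithin] with x (hx : 0 < x)
      exact div_pos hx hl
  refine (key.comp hscale).congr' ?_
  filter_upwards [self_mem_nhdsWithin] with x (hx : 0 < x)
  simp only [Function.comp_def]
  rw [kCDF_one_eq hl hx, Real.log_div hx.ne' hl.ne']
  congr 1
  field_simp
  ring

/-! ### Logarithmic order, special coefficients and reduction to the threshold. -/

/-- If `F x ~ x (B - a log x)` as `x → 0+`, then `log F x / log x → 1`. -/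
theorem tendsto_log_div_log {F : ℝ → ℝ} {a B : ℝ} (hab : 0 < a ∨ (a = 0 ∧ 0 < B))
    (hF : Tendsto (fun x => F x / (x * (-a * Real.log x + B))) (𝓝[>] 0) (𝓝 1)) :
    Tendsto (fun x => Real.log (F x) / Real.log x) (𝓝[>] 0) (𝓝 1) := by
  have hlog : Tendsto (fun x : ℝ => -Real.log x) (𝓝[>] 0) atTop :=
    tendsto_neg_atBot_atTop.comp Real.tendsto_log_nhdsGT_zero
  have hinv : Tendsto (fun x : ℝ => (Real.log x)⁻¹) (𝓝[>] 0) (𝓝 0) :=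
    tendsto_inv_atBot_zero.comp Real.tendsto_log_nhdsGT_zero
  have hL : (∀ᶠ x in 𝓝[>] 0, 0 < -a * Real.log x + B) ∧
      Tendsto (fun x => Real.log (-a * Real.log x + B) / Real.log x) (𝓝[>] 0) (𝓝 0) := by
    rcases hab with ha | ⟨rfl, hB⟩
    · have hw : Tendsto (fun x : ℝ => -a * Real.log x + B) (𝓝[>] 0) atTop := by
        have := tendsto_atTop_add_const_right _ B (hlog.const_mul_atTop ha)
        simpa [neg_mul, mul_neg] using this
      refine ⟨hw.eventually_gt_atTop 0, ?_⟩
      have h1 : Tendsto (fun w : ℝ => Real.log w / w) atTop (𝓝 0) :=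
        Real.isLittleO_log_id_atTop.tendsto_div_nhds_zero
      have h2 : Tendsto (fun x : ℝ => -a + B * (Real.log x)⁻¹) (𝓝[>] 0) (𝓝 (-a)) := by
        simpa using (hinv.const_mul B).const_add (-a)
      have h3 := (h1.comp hw).mul h2
      rw [zero_mul] at h3
      refine h3.congr' ?_
      filter_upwards [hw.eventually_gt_atTop 0, hlog.eventually_gt_atTop 0] with x hx hx'
      have hne : Real.log x ≠ 0 := by linarith
      simp only [Function.comp_def]
      -- With `w = B - a log x`, write `log w / log x` as `(log w / w) (w / log x)`: the first
      -- factor tends to 0 and the second to `-a`.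
      have : -a + B * (Real.log x)⁻¹ = (-a * Real.log x + B) / Real.log x := by field_simp
      rw [this, div_mul_div_cancel₀ hx.ne']
    · simp only [neg_zero, zero_mul, zero_add]
      have h1 := hinv.const_mul (Real.log B)
      rw [mul_zero] at h1
      exact ⟨Eventually.of_forall fun _ => hB, h1⟩
  obtain ⟨hLpos, hL0⟩ := hL
  have h1 : Tendsto (fun x => Real.log (F x / (x * (-a * Real.log x + B))) * (Real.log x)⁻¹ +
      (1 + Real.log (-a * Real.log x + B) / Real.log x)) (𝓝[>] 0) (𝓝 1) := by
    have := ((hF.log one_ne_zero).mul hinv).add (hL0.const_add 1)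
    simpa using this
  refine h1.congr' ?_
  filter_upwards [hLpos, hlog.eventually_gt_atTop 0, hF.eventually_const_lt one_pos,
    self_mem_nhdsWithin] with x hx1 hx2 hx3 (hx4 : 0 < x)
  have hne : Real.log x ≠ 0 := by linarith
  have hd : 0 < x * (-a * Real.log x + B) := by positivity
  have hFx : 0 < F x := by
    rwa [lt_div_iff₀ hd, zero_mul] at hx3
  rw [Real.log_div hFx.ne' hd.ne', Real.log_mul hx4.ne' hx1.ne']
  field_simp
  ring

/-- With no other eigenvalue `H_i` is the empty product 1, so only its zeroth derivative, `k = m_i`,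
survives. -/
theorem coeff_of_subsingleton {q : ℕ} (lam : Fin q → ℝ) (m : Fin q → ℕ) (hq : q = 1) (i : Fin q)
    {k : ℕ} (hk : k ≤ m i) : coeff lam m i k = if k = m i then 1 else 0 := by
  subst hq
  have h : auxH lam m i = fun _ => (1 : ℝ) := by
    ext u
    rw [auxH, Finset.prod_eq_one]
    intro j hj
    exact absurd (Subsingleton.elim j i) (Finset.mem_erase.1 hj).1
  rw [coeff, h, iteratedDeriv_const]
  by_cases hk' : k = m i
  · simp [hk']
  · rw [if_neg (by omega), if_neg hk', zero_div]

theorem coeff_one_of_mult_one {q : ℕ} (lam : Fin q → ℝ) (m : Fin q → ℕ) (hlam : ∀ i, 0 < lam i)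
    (hm : ∀ i, m i = 1) (i : Fin q) :
    coeff lam m i 1 = ∏ j ∈ Finset.univ.erase i, lam i / (lam i - lam j) := by
  rw [coeff, hm, Nat.sub_self, iteratedDeriv_zero, auxH]
  simp only [Nat.factorial_zero, Nat.cast_one, div_one]
  refine Finset.prod_congr rfl fun j _ => ?_
  have := (hlam i).ne'
  rw [hm, Nat.cast_one, zpow_neg_one, mul_zero, zero_add, one_sub_div this, inv_div]

theorem logb_le_iff_le_threshold {G Lf Lu R₀ snr : ℝ} (hG : 0 ≤ G) (hLf : 0 < Lf) (hLu : 0 < Lu)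
    (hsnr : 0 < snr) :
    Real.logb 2 (1 + snr * Lf * Lu * G) ≤ R₀ ↔ G ≤ threshold Lf Lu R₀ snr := by
  have h : 0 < snr * Lf * Lu := by positivity
  rw [Real.logb_le_iff_le_rpow one_lt_two (by positivity), threshold, le_div_iff₀ h]
  constructor <;> intro h' <;> linarith

theorem gain_nonneg {M : ℕ} (A : Matrix (Fin M) (Fin M) ℂ) (u f : Fin M → ℂ) : 0 ≤ gain A u f := by
  unfold gain; positivity

theorem outage_eq {Ω : Type*} [MeasurableSpace Ω] {P : Measure Ω} [IsProbabilityMeasure P]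
    {M : ℕ} (A : Matrix (Fin M) (Fin M) ℂ) {gf gu : Ω → Fin M → ℂ}
    (hgf : HasLaw gf (cgaussVec M) P) (hgu : HasLaw gu (cgaussVec M) P) (hind : IndepFun gf gu P)
    {Lf Lu R₀ snr : ℝ} (hLf : 0 < Lf) (hLu : 0 < Lu) (hsnr : 0 < snr) :
    outage P (fun ω => gain A (gu ω) (gf ω)) Lf Lu R₀ snr =
      ((cgaussVec M).prod (cgaussVec M)).real {p | gain A p.2 p.1 ≤ threshold Lf Lu R₀ snr} := by
  have hmg : Measurable fun p : (Fin M → ℂ) × (Fin M → ℂ) => gain A p.2 p.1 := by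
    unfold gain Matrix.mulVec dotProduct
    simp only [Pi.star_apply]
    fun_prop
  have hmap := (indepFun_iff_map_prod_eq_prod_map_map hgf.aemeasurable hgu.aemeasurable).1 hind
  rw [hgf.map_eq, hgu.map_eq] at hmap
  rw [← hmap, measureReal_def, Measure.map_apply_of_aemeasurable
    (hgf.aemeasurable.prodMk hgu.aemeasurable) (measurableSet_le hmg measurable_const), outage,
    measureReal_def]
  congr 2
  ext ω
  exact logb_le_iff_le_threshold (gain_nonneg _ _ _) hLf hLu hsnr

/-! ### The exact law of the gain and its behaviour near zero. -/

section

variable {M q : ℕ} {A : Matrix (Fin M) (Fin M) ℂ} {lam : Fin q → ℝ} {m : Fin q → ℕ}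

theorem IsPosSpectrum.prod_inv {K : Type*} [Field K] [Algebra ℝ K]
    {C : Matrix (Fin M) (Fin M) ℂ} (h : IsPosSpectrum C lam m)
    (hC : C.PosSemidef) (z : K) :
    ∏ l, (1 + z * algebraMap ℝ K (hC.isHermitian.eigenvalues l))⁻¹ =
      ∏ i, ((1 + z * algebraMap ℝ K (lam i)) ^ m i)⁻¹ := by
  rw [h.prod_eigenvalues hC (fun d => (1 + z * algebraMap ℝ K d)⁻¹) (by simp)]
  simp_rw [inv_pow]

theorem prod_real_gain_le_eq_sum (hA : A ≠ 0) (h : IsPosSpectrum (A * Aᴴ) lam m) {x : ℝ}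
    (hx : 0 < x) :
    ((cgaussVec M).prod (cgaussVec M)).real {p | gain A p.2 p.1 ≤ x} =
      ∑ i, ∑ k ∈ Finset.Icc 1 (m i), coeff lam m i k * kCDF k (lam i) x := by
  have hC := Matrix.posSemidef_self_mul_conjTranspose A
  have hC0 : A * Aᴴ ≠ 0 := by simpa using hA
  obtain ⟨U, hU, hUC⟩ := exists_unitary_conj_diagonal hC.isHermitian
  rw [prod_real_gain_le A U _ hC.eigenvalues_nonneg (exists_eigenvalues_pos hC hC0) hU hUC hx]
  exact integral_one_sub_exp_weightedNormSq hC.eigenvalues_nonneg (h.card_pos hC hC0) h.pos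
    h.injective h.one_le_mult (fun z => h.prod_inv hC z) hx

/-- The split is by total multiplicity. If it is 1, there is a single simple eigenvalue and `S₁ = 1
/ λ > 0`; otherwise `S₁ = 0` and the constant `S₂ + S₃ = E[1/Q]` takes over. The sign information is
what the diversity order needs. -/
theorem tendsto_sum_kCDF_div {C : Matrix (Fin M) (Fin M) ℂ} (hC : C.PosSemidef) (hC0 : C ≠ 0)
    (h : IsPosSpectrum C lam m) :
    (0 < S₁ lam m ∨ (S₁ lam m = 0 ∧ 0 < S₂ lam m + S₃ lam m)) ∧
    Tendsto (fun x : ℝ => (∑ i, ∑ k ∈ Finset.Icc 1 (m i), coeff lam m i k * kCDF k (lam i) x) /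
      (x * (-S₁ lam m * Real.log x + (S₂ lam m + S₃ lam m)))) (𝓝[>] 0) (𝓝 1) := by
  have hq := h.card_pos hC hC0
  have hm := h.one_le_mult
  rcases Nat.lt_or_ge (∑ i, m i) 2 with h2 | h2
  · have hq1 : q = 1 := by
      have : ∑ i : Fin q, 1 ≤ ∑ i, m i := Finset.sum_le_sum fun i _ => hm i
      simp at this
      omega
    subst hq1
    have hm1 : m 0 = 1 := by
      have := hm 0
      simp at h2
      omega
    have hc : coeff lam m 0 1 = 1 := by
      rw [coeff_of_subsingleton lam m rfl 0 hm1.ge, if_pos hm1.symm]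
    have e1 : S₁ lam m = 1 / lam 0 := by simp [S₁, hc]
    have e2 : S₂ lam m = Real.log (lam 0) / lam 0 := by simp [S₂, hc]
    have e3 : S₃ lam m = 0 := by simp [S₃, hm1]
    have hl := h.pos 0
    refine ⟨Or.inl (by rw [e1]; positivity), ?_⟩
    rw [e1, e2, e3]
    simpa [hm1, hc] using tendsto_kCDF_one_div hl
  · have hS := S₁_eq_zero lam m hq h.pos h.injective hm h2
    have hpos := S₂_add_S₃_pos lam m hq h.pos h.injective hm h2
    refine ⟨Or.inr ⟨hS, hpos⟩, ?_⟩
    obtain ⟨hi, he⟩ := integral_prod_inv_pow lam m hq h.pos h.injective hm h2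
    have hd := hC.eigenvalues_nonneg
    have hQ := ae_weightedNormSq_pos hd (exists_eigenvalues_pos hC hC0)
    have hQm := measurable_weightedNormSq hC.isHermitian.eigenvalues
    have hlap : ∀ s, 0 < s → ∫ w, Real.exp (-(s * weightedNormSq hC.isHermitian.eigenvalues w))
        ∂cgaussVec M = ∏ i, ((1 + s * lam i) ^ m i)⁻¹ := by
      intro s hs
      have h1 := integral_cgaussVec_cexp_normSq hC.isHermitian.eigenvalues hd (z := s)
        (by simpa using hs.le)
      have h3 := h.prod_inv hC s
      simp only [Algebra.algebraMap_self, RingHom.id_apply] at h3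
      rw [← h3, ← Complex.ofReal_inj, ← integral_complex_ofReal]
      push_cast
      rw [← h1]
      simp [weightedNormSq]
    obtain ⟨hint, hval⟩ := integrable_inv_of_laplace hQm hQ hlap hi
    have hlim := tendsto_integral_one_sub_exp_div hQm hQ hint
    rw [hval, he] at hlim
    have := hlim.div_const (S₂ lam m + S₃ lam m)
    rw [div_self hpos.ne'] at this
    refine this.congr' ?_
    filter_upwards [self_mem_nhdsWithin] with x (hx : 0 < x)
    rw [integral_one_sub_exp_weightedNormSq hd hq h.pos h.injective hm
      (fun z => h.prod_inv hC z) hx, hS, neg_zero, zero_mul, zero_add, div_div]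

end

theorem tendsto_const_div_nhdsGT_zero {c : ℝ} (hc : 0 < c) :
    Tendsto (fun s : ℝ => c / s) atTop (𝓝[>] 0) := by
  refine tendsto_nhdsWithin_iff.2 ⟨tendsto_const_nhds.div_atTop tendsto_id, ?_⟩
  filter_upwards [eventually_gt_atTop 0] with s hs using div_pos hc hs

theorem tendsto_log_const_div_div_log {c : ℝ} (hc : 0 < c) :
    Tendsto (fun s : ℝ => Real.log (c / s) / Real.log s) atTop (𝓝 (-1)) := by
  have h := ((tendsto_inv_atTop_zero.comp Real.tendsto_log_atTop).const_mul (Real.log c)).sub_const 1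
  rw [mul_zero, zero_sub] at h
  refine h.congr' ?_
  filter_upwards [eventually_gt_atTop 1] with s hs
  have := (Real.log_pos hs).ne'
  simp only [Function.comp_def]
  rw [Real.log_div hc.ne' (by positivity)]
  field_simp

theorem coupling_one {M : ℕ} (θ : Fin M → ℝ) :
    coupling (1 : Matrix (Fin M) (Fin M) ℂ) θ = reflection θ := by
  rw [coupling, CFC.sqrt_one, one_mul, mul_one]

theorem gram_one {M : ℕ} (θ : Fin M → ℝ) : gram (1 : Matrix (Fin M) (Fin M) ℂ) θ = 1 := by
  rw [gram, coupling_one, reflection, Matrix.diagonal_conjTranspose, Matrix.diagonal_mul_diagonal,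
    ← Matrix.diagonal_one]
  congr 1
  ext l
  simp only [Pi.star_apply, RCLike.star_def]
  rw [Complex.mul_conj, Complex.normSq_eq_norm_sq, Complex.norm_exp_ofReal_mul_I]
  simp

theorem IsPosSpectrum.eq_of_one {M q : ℕ} {lam : Fin q → ℝ} {m : Fin q → ℕ}
    (h : IsPosSpectrum (1 : Matrix (Fin M) (Fin M) ℂ) lam m) (i : Fin q) :
    lam i = 1 ∧ m i = M := by
  have h1 : lam i = 1 := by
    have := ((h.mem_iff (lam i)).1 ⟨i, rfl⟩).2
    rw [hasEigenvalue_toLin'_iff_isRoot, Matrix.charpoly_one, Polynomial.IsRoot] at this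
    simp only [Polynomial.eval_pow, Polynomial.eval_sub, Polynomial.eval_X,
      Polynomial.eval_one] at this
    by_contra hne
    exact pow_ne_zero _ (sub_ne_zero.2 (by exact_mod_cast hne)) this
  refine ⟨h1, ?_⟩
  rw [h.mult, h1, Matrix.charpoly_one]
  have := Polynomial.rootMultiplicity_X_sub_C_pow (1 : ℂ) M
  simpa using this

end FRIS

theorem mainTheorem5 {Ω : Type*} [MeasurableSpace Ω] (P : Measure Ω) [IsProbabilityMeasure P]
    {M : ℕ} (R : Matrix (Fin M) (Fin M) ℂ) (hR : R.PosSemidef) (θ : Fin M → ℝ)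
    (hA : coupling R θ ≠ 0)
    (gf gu : Ω → Fin M → ℂ) (hgf : HasLaw gf (cgaussVec M) P) (hgu : HasLaw gu (cgaussVec M) P)
    (hind : IndepFun gf gu P)
    (Lf Lu R₀ : ℝ) (hLf : 0 < Lf) (hLu : 0 < Lu) (hR₀ : 0 < R₀)
    {q : ℕ} (lam : Fin q → ℝ) (m : Fin q → ℕ) (hspec : IsPosSpectrum (gram R θ) lam m)
    (Pout : ℝ → ℝ)
    (hPout : Pout = outage P (fun ω => gain (coupling R θ) (gu ω) (gf ω)) Lf Lu R₀)
    (Rt : ℝ → ℝ) (hRt : Rt = threshold Lf Lu R₀) :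
    -- closed form of the `K`-distribution function
    (∀ k : ℕ, 1 ≤ k → ∀ l x : ℝ, 0 < l → 0 < x →
      kCDF k l x =
        1 - 2 / Real.Gamma k * (x / l) ^ ((k : ℝ) / 2) * besselK k (2 * √(x / l))) ∧
    -- general multiplicities: exact and asymptotic outage probability
    (∀ snr : ℝ, 0 < snr →
      Pout snr = ∑ i, ∑ k ∈ Finset.Icc 1 (m i), coeff lam m i k * kCDF k (lam i) (Rt snr)) ∧
    Tendsto (fun snr : ℝ => Pout snr /
        (((2 : ℝ) ^ R₀ - 1) / (Lf * Lu * snr) *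
          (S₁ lam m * Real.log snr - S₁ lam m * Real.log (((2 : ℝ) ^ R₀ - 1) / (Lf * Lu))
            + S₂ lam m + S₃ lam m))) atTop (𝓝 1) ∧
    -- simple eigenvalues
    ((∀ i, m i = 1) →
      (∀ i, coeff lam m i 1 = ∏ j ∈ Finset.univ.erase i, lam i / (lam i - lam j)) ∧
      (∀ snr : ℝ, 0 < snr →
        Pout snr = ∑ i, coeff lam m i 1 *
          (1 - 2 * √(Rt snr / lam i) * besselK 1 (2 * √(Rt snr / lam i)))) ∧
      Tendsto (fun snr : ℝ => Pout snr /
        (((2 : ℝ) ^ R₀ - 1) / (Lf * Lu * snr) *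
          (S₁ lam m * Real.log snr - S₁ lam m * Real.log (((2 : ℝ) ^ R₀ - 1) / (Lf * Lu))
            + S₂ lam m))) atTop (𝓝 1)) ∧
    -- a single distinct positive eigenvalue
    (q = 1 → ∀ i : Fin q,
      (∀ snr : ℝ, 0 < snr →
        Pout snr = 1 - 2 / Real.Gamma (m i) * lam i ^ (-(m i : ℝ) / 2) *
          Rt snr ^ ((m i : ℝ) / 2) * besselK (m i) (2 * √(Rt snr / lam i))) ∧
      (2 ≤ m i →
        Tendsto (fun snr : ℝ => Pout snr /
          (((2 : ℝ) ^ R₀ - 1) / (((m i : ℝ) - 1) * lam i * Lf * Lu * snr))) atTop (𝓝 1))) ∧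
    -- uncorrelated elements
    (R = 1 →
      (∀ snr : ℝ, 0 < snr →
        Pout snr = 1 - 2 / Real.Gamma M * Rt snr ^ ((M : ℝ) / 2) *
          besselK M (2 * √(Rt snr))) ∧
      (2 ≤ M →
        Tendsto (fun snr : ℝ => Pout snr /
          (((2 : ℝ) ^ R₀ - 1) / (((M : ℝ) - 1) * Lf * Lu * snr))) atTop (𝓝 1))) ∧
    -- the diversity order is one, in all of these regimes
    Tendsto (fun snr : ℝ => -(Real.log (Pout snr) / Real.log snr)) atTop (𝓝 1) := by
  subst hPout hRt
  have hC : (gram R θ).PosSemidef := Matrix.posSemidef_self_mul_conjTranspose _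
  have hC0 : gram R θ ≠ 0 := by simpa [gram] using hA
  have hq := hspec.card_pos hC hC0
  have hm := hspec.one_le_mult
  set c : ℝ := ((2 : ℝ) ^ R₀ - 1) / (Lf * Lu) with hc
  have hc0 : 0 < c := by
    have : (1 : ℝ) < 2 ^ R₀ := Real.one_lt_rpow one_lt_two hR₀
    exact div_pos (by linarith) (by positivity)
  have hthr : ∀ snr : ℝ, threshold Lf Lu R₀ snr = c / snr := by
    intro snr
    rw [threshold, hc, div_div]
    ring_nf
  have hthr0 : ∀ snr : ℝ, 0 < snr → 0 < threshold Lf Lu R₀ snr := fun snr h => by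
    rw [hthr]; positivity
  have hexact : ∀ snr : ℝ, 0 < snr →
      outage P (fun ω => gain (coupling R θ) (gu ω) (gf ω)) Lf Lu R₀ snr =
        ∑ i, ∑ k ∈ Finset.Icc 1 (m i),
          coeff lam m i k * kCDF k (lam i) (threshold Lf Lu R₀ snr) := by
    intro snr hsnr
    rw [outage_eq (coupling R θ) hgf hgu hind hLf hLu hsnr,
      prod_real_gain_le_eq_sum hA hspec (hthr0 snr hsnr)]
  obtain ⟨hS, hlim⟩ := tendsto_sum_kCDF_div hC hC0 hspec
  -- The limit at `x → 0+` is read at `x = c / snr`, where `-S₁ log x = S₁ log snr - S₁ log c`.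
  have hasymp := (hlim.comp (tendsto_const_div_nhdsGT_zero hc0)).congr' (f₂ := fun snr : ℝ =>
      outage P (fun ω => gain (coupling R θ) (gu ω) (gf ω)) Lf Lu R₀ snr /
        (((2 : ℝ) ^ R₀ - 1) / (Lf * Lu * snr) *
          (S₁ lam m * Real.log snr - S₁ lam m * Real.log c + S₂ lam m + S₃ lam m))) (by
    filter_upwards [eventually_gt_atTop 0] with snr hsnr
    rw [hexact snr hsnr, ← div_div (_ - _) (Lf * Lu) snr, ← hc]
    simp only [Function.comp_def, hthr]
    congr 2
    rw [Real.log_div hc0.ne' hsnr.ne']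
    ring)
  have hone : q = 1 → ∀ i : Fin q,
      (∀ snr : ℝ, 0 < snr →
        outage P (fun ω => gain (coupling R θ) (gu ω) (gf ω)) Lf Lu R₀ snr =
          1 - 2 / Real.Gamma (m i) * lam i ^ (-(m i : ℝ) / 2) *
          threshold Lf Lu R₀ snr ^ ((m i : ℝ) / 2) *
            besselK (m i) (2 * √(threshold Lf Lu R₀ snr / lam i))) ∧
      (2 ≤ m i →
        Tendsto (fun snr : ℝ =>
          outage P (fun ω => gain (coupling R θ) (gu ω) (gf ω)) Lf Lu R₀ snr /
          (((2 : ℝ) ^ R₀ - 1) / (((m i : ℝ) - 1) * lam i * Lf * Lu * snr))) atTop (𝓝 1)) := by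
    intro hq1 i
    have hcoeff := fun (k : ℕ) (hk : k ≤ m i) => coeff_of_subsingleton lam m hq1 i hk
    have huniv : (Finset.univ : Finset (Fin q)) = {i} := by
      subst hq1
      ext j
      exact ⟨fun _ => Finset.mem_singleton.2 (Subsingleton.elim j i), fun _ => Finset.mem_univ _⟩
    constructor
    · intro snr hsnr
      have ht := hthr0 snr hsnr
      have hl := hspec.pos i
      rw [hexact snr hsnr, huniv, Finset.sum_singleton, Finset.sum_eq_single (m i),
        hcoeff _ le_rfl, if_pos rfl, one_mul, kCDF_eq_one_sub (hm i) hl ht,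
        Real.div_rpow ht.le hl.le, neg_div, Real.rpow_neg hl.le]
      · ring
      · intro k hk hne
        rw [hcoeff k (Finset.mem_Icc.1 hk).2, if_neg hne, zero_mul]
      · intro h
        exact absurd (Finset.mem_Icc.2 ⟨hm i, le_rfl⟩) h
    · intro h2
      -- For a multiplicity of at least 2 the only nonzero coefficient is `c_{i,m_i} = 1`, so `S₁`
      -- and `S₂` vanish and `S₃` has one term.
      have h1 : coeff lam m i 1 = 0 := by rw [hcoeff 1 (hm i), if_neg (by omega)]
      have e1 : S₁ lam m = 0 := by simp [S₁, huniv, h1]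
      have e2 : S₂ lam m = 0 := by simp [S₂, huniv, h1]
      have e3 : S₃ lam m = 1 / (((m i : ℝ) - 1) * lam i) := by
        rw [S₃, huniv, Finset.sum_singleton, Finset.sum_eq_single (m i), hcoeff _ le_rfl,
          if_pos rfl]
        · intro k hk hne
          rw [hcoeff k (Finset.mem_Icc.1 hk).2, if_neg hne, zero_div]
        · intro h
          exact absurd (Finset.mem_Icc.2 ⟨h2, le_rfl⟩) h
      refine hasymp.congr fun snr => ?_
      rw [e1, e2, e3]
      congr 1
      rw [zero_mul, zero_mul, sub_zero, zero_add, zero_add, div_mul_div_comm, mul_one]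
      ring_nf
  refine ⟨fun k hk l x hl hx => kCDF_eq_one_sub hk hl hx, hexact, hasymp, ?_, hone, ?_, ?_⟩
  · intro hm1
    refine ⟨coeff_one_of_mult_one lam m hspec.pos hm1, ?_, ?_⟩
    · intro snr hsnr
      rw [hexact snr hsnr]
      refine Finset.sum_congr rfl fun i _ => ?_
      rw [hm1 i, Finset.Icc_self, Finset.sum_singleton,
        kCDF_eq_one_sub le_rfl (hspec.pos i) (hthr0 snr hsnr), Real.sqrt_eq_rpow]
      simp
    · have e3 : S₃ lam m = 0 := by simp [S₃, hm1]
      simpa [e3] using hasymp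
  · intro hR1
    subst hR1
    rw [gram_one] at hspec
    -- For `R = 1` the Gram matrix is the identity whatever the phases, so its only eigenvalue is 1,
    -- with multiplicity `M`.
    have hq1 : q = 1 := by
      have : Subsingleton (Fin q) := ⟨fun i j =>
        hspec.injective ((hspec.eq_of_one i).1.trans (hspec.eq_of_one j).1.symm)⟩
      have := Fintype.card_le_one_iff_subsingleton.2 this
      rw [Fintype.card_fin] at this
      omega
    obtain ⟨hl1, hmM⟩ := hspec.eq_of_one ⟨0, hq⟩
    obtain ⟨h1, h2⟩ := hone hq1 ⟨0, hq⟩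
    rw [hl1, hmM] at h1 h2
    simpa using And.intro h1 h2
  -- Write `log Pout / log snr` as `(log Pout / log x) (log x / log snr)` with `x = c / snr`; the
  -- factors tend to `1` and `-1`. Cancelling `log x` needs `x < 1`, true for large `snr`.
  · have h1 := ((tendsto_log_div_log hS hlim).comp (tendsto_const_div_nhdsGT_zero hc0)).mul
      (tendsto_log_const_div_div_log hc0)
    have h2 := h1.neg
    rw [one_mul, neg_neg] at h2
    refine h2.congr' ?_
    have hne := (tendsto_const_div_nhdsGT_zero hc0).eventually
      (Ioo_mem_nhdsGT (one_pos (α := ℝ)))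
    filter_upwards [eventually_gt_atTop 0, hne] with snr hsnr hlt
    simp only [Function.comp_def]
    rw [hexact snr hsnr, hthr, div_mul_div_cancel₀ (Real.log_neg hlt.1 hlt.2).ne]
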